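/- Let $\mathcal X_1,\mathcal X_2,\mathcal X_3,\mathcal V_1,\mathcal V_2,\mathcal U_1,\mathcal U_2$ be finite alphabets, and let logarithms, entropies and (conditional) mutual informations be in bits. For a probability mass function (pmf) $p$ on a finite set $\mathcal A$, $\epsilon>0$ and $n\ge1$, let $\mathcal T^n_{[p]\epsilon}$ be the set of strongly $\epsilon$-typical sequences, i.e. of all $a^n\in\mathcal A^n$ with $\left|\frac{N(a|a^n)}{n}-p(a)\right|\le\frac{\epsilon}{|\mathcal A|}$ for every $a\in\mathcal A$ with $p(a)\ne0$, where $N(a|a^n)$ is the number of occurrences of $a$ in $a^n$. A tuple of sequences of length $n$ is jointly typical if it is typical when read as a sequence of tuples. Let $q$ be a pmf on $\mathcal X_1\times\mathcal X_2\times\mathcal X_3\times\mathcal V_1\times\mathcal V_2$, and for each $n$ let $(X_1^n,X_2^n,X_3^n,V_1^n,V_2^n)$ be random vectors of length $n$ over these alphabets, with an arbitrary joint law (not necessarily i.i.d.), such that for every $\epsilon>0$ $$\lim_{n\to\infty}\Pr\left\{(X_1^n,X_2^n,X_3^n,V_1^n,V_2^n)\in\mathcal T^n_{[q]\epsilon}\right\}=1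 .$$ A cooperative code of block length $n$ consists of finite index sets $\mathcal M_1,\mathcal M_2$ and maps $$f_1:\mathcal X_1^n\times\mathcal V_1^n\to\mathcal M_1,\qquad f_2:\mathcal X_2^n\times\mathcal V_1^n\times\mathcal M_1\to\mathcal M_2,\qquad g:\mathcal X_3^n\times\mathcal V_1^n\times\mathcal V_2^n\times\mathcal M_1\times\mathcal M_2\to\mathcal U_1^n\times\mathcal U_2^n .$$ Thus encoder 1 sends $M_1=f_1(X_1^n,V_1^n)$ to encoder 2 and to the decoder, encoder 2 sends $M_2=f_2(X_2^n,V_1^n,M_1)$ to the decoder, and the decoder outputs $(\hat U_1^n,\hat U_2^n)=g(X_3^n,V_1^n,V_2^n,M_1,M_2)$. Let $\mathcal P(q)$ be the set of pmfs $p=p_{X_1X_2X_3V_1V_2U_1U_2}$ whose marginal on $(X_1,X_2,X_3,V_1,V_2)$ is $q$ and which satisfy the Markov chains $$U_1-(X_1,V_1)-(X_2,X_3,V_2),\qquad U_2-(U_1,X_2,V_1)-(X_1,X_3,V_2).$$ A pair $(R_1,R_2)$ is achievable for $p\in\mathcal P(q)$ if for every $\epsilon>0$ there is $n_0$ such that for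 every $n>n_0$ there is a cooperative code of block length $n$ with $\frac1n\log|\mathcal M_1|\le R_1+\epsilon$, $\frac1n\log|\mathcal M_2|\le R_2+\epsilon$ and $$\Pr\left\{(X_1^n,X_2^n,X_3^n,V_1^n,V_2^n,\hat U_1^n,\hat U_2^n)\notin\mathcal T^n_{[p]\epsilon}\right\}\le\epsilon .$$ Theorem. For every $p\in\mathcal P(q)$, every pair $(R_1,R_2)$ with $$R_1>I(X_1;U_1|X_2V_1),\qquad R_2>I(X_2;U_2|X_3V_1V_2U_1),\qquad R_1+R_2>I(X_1X_2;U_1U_2|X_3V_1V_2)$$ (mutual informations computed under $p$) is achievable for $p$. Consequently, let $\mathcal R_{CBT}^{\mathrm{inner}}$ be the closure of the union over $p\in\mathcal P(q)$ of the sets of rate pairs satisfying these three inequalities, and let $\mathcal R_{CBT}$ be the closure of the set of rate pairs that are achievable for some $p\in\mathcal P(q)$. Then $\mathcal R_{CBT}^{\mathrm{inner}}\subseteq\mathcal R_{CBT}$. -/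

import Mathlib

open Filter Topology

namespace CoopBT

section Generic

variable {α β γ δ : Type*}

open Classical in
/-- Probability of the event `E` under the mass function `p` on a finite type. -/
noncomputable def prob [Fintype α] (p : α → ℝ) (E : Set α) : ℝ :=
  ∑ a with a ∈ E, p a

/-- The law of the random variable `f`, when the underlying letter is drawn from `p`. -/
noncomputable def law [Fintype α] (p : α → ℝ) (f : α → β) : β → ℝ :=
  fun b => prob p {a | f a = b}

/-- Shannon entropy `H(f)`, in bits, of the finitely-valued random variable `f` under `p`. -/
noncomputable def entropy [Fintype α] [Fintype β] (p : α → ℝ) (f : α → β) : ℝ :=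
  (∑ b, Real.negMulLog (law p f b)) / Real.log 2

/-- Conditional mutual information
`I(f ; g | h) = H(f, h) + H(g, h) - H(f, g, h) - H(h)`, in bits. -/
noncomputable def condMutualInfo [Fintype α] [Fintype β] [Fintype γ] [Fintype δ]
    (p : α → ℝ) (f : α → β) (g : α → γ) (h : α → δ) : ℝ :=
  entropy p (fun a => (f a, h a)) + entropy p (fun a => (g a, h a))
    - entropy p (fun a => (f a, g a, h a)) - entropy p h

/-- The Markov chain `f - g - h`: `p(x | y, v) = p(x | y)`, with denominators cleared. -/
def IsMarkovChain [Fintype α] (p : α → ℝ) (f : α → β) (g : α → γ) (h : α → δ) : Prop :=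
  ∀ x y v, law p (fun a => (f a, g a, h a)) (x, y, v) * law p g y
    = law p (fun a => (f a, g a)) (x, y) * law p (fun a => (g a, h a)) (y, v)

open Classical in
/-- `N(a | x)`: the number of occurrences of the letter `a` in the sequence `x`. -/
noncomputable def occurrences {n : ℕ} (x : Fin n → α) (a : α) : ℕ :=
  (Finset.univ.filter fun t => x t = a).card

/-- Strongly `ε`-typical sequences of length `n` for `p`. A tuple of sequences of equal length
is identified with a sequence of tuples, so this covers jointly typical sequences as well. -/
def typicalSet [Fintype α] (p : α → ℝ) (ε : ℝ) (n : ℕ) : Set (Fin n → α) :=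
  {x | ∀ a, p a ≠ 0 → |(occurrences x a : ℝ) / n - p a| ≤ ε / Fintype.card α}

end Generic

section Problem

/-- A letter `(x₁, x₂, x₃, v₁, v₂)`. -/
abbrev Source (X₁ X₂ X₃ V₁ V₂ : Type*) := X₁ × X₂ × X₃ × V₁ × V₂

/-- A letter `((x₁, x₂, x₃, v₁, v₂), u₁, u₂)`. -/
abbrev Joint (X₁ X₂ X₃ V₁ V₂ U₁ U₂ : Type*) := Source X₁ X₂ X₃ V₁ V₂ × U₁ × U₂

variable {X₁ X₂ X₃ V₁ V₂ U₁ U₂ : Type*}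

/-- Coordinate `x₁`: the first source. -/
def rvX₁ (s : Joint X₁ X₂ X₃ V₁ V₂ U₁ U₂) : X₁ := s.1.1
/-- Coordinate `x₂`: the second source. -/
def rvX₂ (s : Joint X₁ X₂ X₃ V₁ V₂ U₁ U₂) : X₂ := s.1.2.1
/-- Coordinate `x₃`: the third source. -/
def rvX₃ (s : Joint X₁ X₂ X₃ V₁ V₂ U₁ U₂) : X₃ := s.1.2.2.1
/-- Coordinate `v₁`: the common side information. -/
def rvV₁ (s : Joint X₁ X₂ X₃ V₁ V₂ U₁ U₂) : V₁ := s.1.2.2.2.1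
/-- Coordinate `v₂`: the decoder side information. -/
def rvV₂ (s : Joint X₁ X₂ X₃ V₁ V₂ U₁ U₂) : V₂ := s.1.2.2.2.2
/-- Coordinate `u₁`: the first description. -/
def rvU₁ (s : Joint X₁ X₂ X₃ V₁ V₂ U₁ U₂) : U₁ := s.2.1
/-- Coordinate `u₂`: the second description. -/
def rvU₂ (s : Joint X₁ X₂ X₃ V₁ V₂ U₁ U₂) : U₂ := s.2.2

/-- A cooperative code of block length `n`, with index sets of sizes `size₁` and `size₂`. -/
structure Code (X₁ X₂ X₃ V₁ V₂ U₁ U₂ : Type*) (n : ℕ) where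
  size₁ : ℕ
  size₂ : ℕ
  enc₁ : (Fin n → X₁) → (Fin n → V₁) → Fin size₁
  enc₂ : (Fin n → X₂) → (Fin n → V₁) → Fin size₁ → Fin size₂
  dec : (Fin n → X₃) → (Fin n → V₁) → (Fin n → V₂) → Fin size₁ → Fin size₂ →
    (Fin n → U₁) × (Fin n → U₂)

/-- The decoder's reconstruction `(û₁ⁿ, û₂ⁿ)` when the source block is `s`. -/
def Code.reconstruct {n : ℕ} (c : Code X₁ X₂ X₃ V₁ V₂ U₁ U₂ n)
    (s : Fin n → Source X₁ X₂ X₃ V₁ V₂) : (Fin n → U₁) × (Fin n → U₂) :=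
  let x₁ : Fin n → X₁ := fun t => (s t).1
  let x₂ : Fin n → X₂ := fun t => (s t).2.1
  let x₃ : Fin n → X₃ := fun t => (s t).2.2.1
  let v₁ : Fin n → V₁ := fun t => (s t).2.2.2.1
  let v₂ : Fin n → V₂ := fun t => (s t).2.2.2.2
  let m₁ := c.enc₁ x₁ v₁
  let m₂ := c.enc₂ x₂ v₁ m₁
  c.dec x₃ v₁ v₂ m₁ m₂

/-- The source block together with the decoder's reconstruction. -/
def Code.output {n : ℕ} (c : Code X₁ X₂ X₃ V₁ V₂ U₁ U₂ n)
    (s : Fin n → Source X₁ X₂ X₃ V₁ V₂) : Fin n → Joint X₁ X₂ X₃ V₁ V₂ U₁ U₂ :=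
  fun t => (s t, (c.reconstruct s).1 t, (c.reconstruct s).2 t)

variable [Fintype X₁] [Fintype X₂] [Fintype X₃] [Fintype V₁] [Fintype V₂]
  [Fintype U₁] [Fintype U₂]

/-- `Q n` is the joint law of `(X₁ⁿ, X₂ⁿ, X₃ⁿ, V₁ⁿ, V₂ⁿ)`. The block is jointly typical for the
single-letter law `q` with probability tending to one; no other assumption is made on `Q`. -/
def AsymptoticallyTypical (q : Source X₁ X₂ X₃ V₁ V₂ → ℝ)
    (Q : (n : ℕ) → (Fin n → Source X₁ X₂ X₃ V₁ V₂) → ℝ) : Prop :=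
  ∀ ε : ℝ, 0 < ε → Tendsto (fun n => prob (Q n) (typicalSet q ε n)) atTop (𝓝 1)

/-- The probability mass functions on the joint alphabet with source marginal `q` that satisfy
`U₁ - (X₁, V₁) - (X₂, X₃, V₂)` and `U₂ - (U₁, X₂, V₁) - (X₁, X₃, V₂)`. -/
def admissible (q : Source X₁ X₂ X₃ V₁ V₂ → ℝ) :
    Set (Joint X₁ X₂ X₃ V₁ V₂ U₁ U₂ → ℝ) :=
  {p | p ∈ stdSimplex ℝ (Joint X₁ X₂ X₃ V₁ V₂ U₁ U₂) ∧
    law p Prod.fst = q ∧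
    IsMarkovChain p rvU₁ (fun s => (rvX₁ s, rvV₁ s)) (fun s => (rvX₂ s, rvX₃ s, rvV₂ s)) ∧
    IsMarkovChain p rvU₂ (fun s => (rvU₁ s, rvX₂ s, rvV₁ s))
      (fun s => (rvX₁ s, rvX₃ s, rvV₂ s))}

/-- The rate pairs satisfying
`R₁ > I(X₁; U₁ | X₂ V₁)`, `R₂ > I(X₂; U₂ | X₃ V₁ V₂ U₁)` and
`R₁ + R₂ > I(X₁ X₂; U₁ U₂ | X₃ V₁ V₂)`. -/
def rateRegion (p : Joint X₁ X₂ X₃ V₁ V₂ U₁ U₂ → ℝ) : Set (ℝ × ℝ) :=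
  {R | condMutualInfo p rvX₁ rvU₁ (fun s => (rvX₂ s, rvV₁ s)) < R.1 ∧
    condMutualInfo p rvX₂ rvU₂ (fun s => (rvX₃ s, rvV₁ s, rvV₂ s, rvU₁ s)) < R.2 ∧
    condMutualInfo p (fun s => (rvX₁ s, rvX₂ s)) (fun s => (rvU₁ s, rvU₂ s))
      (fun s => (rvX₃ s, rvV₁ s, rvV₂ s)) < R.1 + R.2}

/-- The rate pairs `R` such that, for every `ε > 0` and every large enough `n`, some code of block
length `n` has rates at most `R.1 + ε` and `R.2 + ε` and its reconstructions fail to be jointly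
`ε`-typical with the sources with probability at most `ε`. -/
def achievableRates (Q : (n : ℕ) → (Fin n → Source X₁ X₂ X₃ V₁ V₂) → ℝ)
    (p : Joint X₁ X₂ X₃ V₁ V₂ U₁ U₂ → ℝ) : Set (ℝ × ℝ) :=
  {R | ∀ ε : ℝ, 0 < ε → ∃ n₀ : ℕ, ∀ n : ℕ, n₀ < n →
    ∃ c : Code X₁ X₂ X₃ V₁ V₂ U₁ U₂ n,
      Real.logb 2 c.size₁ / n ≤ R.1 + ε ∧
      Real.logb 2 c.size₂ / n ≤ R.2 + ε ∧
      prob (Q n) {s | c.output s ∉ typicalSet p ε n} ≤ ε}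

end Problem

end CoopBT

open scoped BigOperators

namespace CoopBT

/-! The coding scheme is random binning with frozen bins. A random function `b₁` hashes each block
u₁ⁿ, and a random function `b₂` hashes each pair (u₁ⁿ, u₂ⁿ), to two indices. The first index is
frozen: it must equal 0 and is never sent. The second is the message.

Encoder 1 wants a block drawn from the test channel p(u₁|x₁v₁) that lies in the frozen bin. If the
number F₁ of frozen values has rate slightly below H(U₁|X₁V₁), the channel has no heavy atoms at
that scale and leaves about its fair share 1/F₁ of mass in the bin (`expect_mass_lt_half_le`). The
same holds for encoder 2 with F₂ of rate below H(U₂|U₁X₂V₁).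

A receiver keeps a list of blocks that are likely given its side information and looks for the one
with the right hash. A wrong candidate survives with probability one over the total hash size. So
encoder 2 recovers u₁ⁿ if the full first hash has rate above H(U₁|X₂V₁). The decoder recovers the
pair if the second hash has rate above H(U₂|X₃V₁V₂U₁), and both together have rate above
H(U₁U₂|X₃V₁V₂) (`expect_hashed_failure`). Subtracting the frozen rates leaves the three mutual
informations, by the Markov chains (`condMutualInfo_first`, `condMutualInfo_second`,
`condMutualInfo_sum`).

All of this is done for a single abstract source block in `exists_code`. The passage to length n
uses only `conditional_lln`, which holds for every fixed typical source block; hence the law of the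
source matters only through the probability of being typical, and no independence over time is
needed. -/

open Classical in
/-- The real-valued indicator of a proposition. -/
noncomputable def ind (P : Prop) : ℝ := if P then 1 else 0

theorem ind_true {P : Prop} (h : P) : ind P = 1 := if_pos h

theorem ind_false {P : Prop} (h : ¬P) : ind P = 0 := if_neg h

theorem ind_nonneg (P : Prop) : 0 ≤ ind P := by
  unfold ind; split_ifs <;> norm_num

theorem ind_le_one (P : Prop) : ind P ≤ 1 := by
  unfold ind; split_ifs <;> norm_num

theorem ind_le_ind {P R : Prop} (h : P → R) : ind P ≤ ind R := by
  by_cases hP : P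
  · rw [ind_true hP, ind_true (h hP)]
  · rw [ind_false hP]; exact ind_nonneg _

theorem prob_eq_sum_ind {α : Type*} [Fintype α] (p : α → ℝ) (E : Set α) :
    prob p E = ∑ a, p a * ind (a ∈ E) := by
  classical
  unfold prob
  rw [Finset.sum_filter]
  refine Finset.sum_congr rfl fun a _ => ?_
  by_cases h : a ∈ E <;> simp [ind, h]

/-! ### Uniformly random hash functions: independence, collisions and preservation of mass. -/

section RandomHash

variable {α β : Type*} [Fintype α] [DecidableEq α] [Fintype β] [Nonempty β]

/-- Resampling one value of a uniformly random function does not change expectations. -/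
theorem expect_update (a : α) (F : (α → β) → ℝ) :
    𝔼 b, F b = 𝔼 b, 𝔼 y, F (Function.update b a y) := by
  have h1 : 𝔼 b : α → β, F b = 𝔼 x : (α → β) × β, F x.1 := by
    rw [← Finset.univ_product_univ, Finset.expect_product]
    simp
  have h2 : 𝔼 b : α → β, 𝔼 y, F (Function.update b a y)
      = 𝔼 x : (α → β) × β, F (Function.update x.1 a x.2) := by
    rw [← Finset.univ_product_univ, Finset.expect_product]
  rw [h1, h2]
  -- Exchanging the stored value at `a` with the fresh sample is a bijection of the product space,
  -- so it preserves the uniform average.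
  have hinv : Function.Involutive
      (fun x : (α → β) × β => (Function.update x.1 a x.2, x.1 a)) := by
    intro x; simp
  exact (Fintype.expect_equiv hinv.toPerm _ _ fun x => rfl).symm

theorem expect_eval (a : α) (φ : β → ℝ) : 𝔼 b : α → β, φ (b a) = 𝔼 y, φ y := by
  rw [expect_update a]
  simp

theorem expect_eval₂ {a a' : α} (h : a ≠ a') (φ : β → β → ℝ) :
    𝔼 b : α → β, φ (b a) (b a') = 𝔼 y, 𝔼 y', φ y y' := by
  rw [expect_update a']
  simp only [Function.update_self, Function.update_of_ne h]
  exact expect_eval a fun y => 𝔼 y', φ y y'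

theorem expect_eval_mul {a a' : α} (h : a ≠ a') (φ ψ : β → ℝ) :
    𝔼 b : α → β, φ (b a) * ψ (b a') = (𝔼 y, φ y) * 𝔼 y, ψ y := by
  rw [expect_eval₂ h fun y y' => φ y * ψ y', Fintype.expect_mul_expect]

theorem expect_collision {a a' : α} (h : a ≠ a') {θ : β → ℝ} (hθ : 𝔼 y, θ y = 1) :
    𝔼 b : α → β, θ (b a) * ind (b a' = b a) = 1 / Fintype.card β := by
  rw [expect_eval₂ h fun y y' => θ y * ind (y' = y)]
  have : ∀ y : β, 𝔼 y', θ y * ind (y' = y) = θ y * (1 / Fintype.card β) := by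
    intro y
    rw [← Finset.mul_expect, Fintype.expect_eq_sum_div_card,
      Finset.sum_eq_single_of_mem y (Finset.mem_univ y) fun y' _ hy => ind_false hy, ind_true rfl]
  simp only [this]
  rw [← Finset.expect_mul, hθ, one_mul]

/-- A random hash keeps about the right share of a distribution with small atoms. -/
theorem expect_mass_lt_half_le {P : α → ℝ} (hP : ∀ u, 0 ≤ P u) (hP1 : ∑ u, P u = 1)
    {θ : β → ℝ} (hθ0 : ∀ y, 0 ≤ θ y) (hθ1 : 𝔼 y, θ y = 1) {F : ℝ} (hF : 1 ≤ F)
    (hθ2 : 𝔼 y, θ y ^ 2 = F) {c : ℝ} (hc : 0 ≤ c) :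
    𝔼 b : α → β, ind (∑ u, P u * θ (b u) < 1 / 2)
      ≤ 16 * ((F - 1) * c) + 4 * ∑ u, P u * ind (c < P u) := by
  set η := ∑ u, P u * ind (c < P u) with hη
  have hη0 : 0 ≤ η := Finset.sum_nonneg fun u _ => mul_nonneg (hP u) (ind_nonneg _)
  have hFc : 0 ≤ (F - 1) * c := mul_nonneg (by linarith) hc
  -- Atoms heavier than `c` are discarded before using a second moment. If they carry mass at least
  -- 1/4 the bound is trivial. Otherwise the truncated mass has mean above 3/4, so falling below 1/2
  -- is a deviation of at least 1/4; its square gives the factor 16.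
  by_cases hη4 : 1 / 4 ≤ η
  · have : 𝔼 b : α → β, ind (∑ u, P u * θ (b u) < 1 / 2) ≤ 1 :=
      Finset.expect_le Finset.univ_nonempty fun _ _ => ind_le_one _
    linarith
  push Not at hη4
  set P' : α → ℝ := fun u => P u * (1 - ind (c < P u)) with hP'
  have hP'0 : ∀ u, 0 ≤ P' u := fun u => mul_nonneg (hP u) (by linarith [ind_le_one (c < P u)])
  have hP'c : ∀ u, P' u ≤ c := by
    intro u
    by_cases h : c < P u
    · simp [hP', ind_true h, hc]
    · simp only [hP', ind_false h]; linarith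
  have hP'P : ∀ u, P' u ≤ P u := fun u => by
    have := mul_nonneg (hP u) (ind_nonneg (c < P u))
    simp only [hP']; linarith
  have hP's : ∑ u, P' u = 1 - η := by
    simp only [hP', mul_sub, mul_one, Finset.sum_sub_distrib, hP1, hη]
  have hpt : ∀ b : α → β, ind (∑ u, P u * θ (b u) < 1 / 2)
      ≤ 16 * (∑ u, P' u * (θ (b u) - 1)) ^ 2 := by
    intro b
    by_cases h : ∑ u, P u * θ (b u) < 1 / 2
    · rw [ind_true h]
      have h1 : ∑ u, P' u * θ (b u) ≤ ∑ u, P u * θ (b u) :=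
        Finset.sum_le_sum fun u _ => mul_le_mul_of_nonneg_right (hP'P u) (hθ0 _)
      have h2 : ∑ u, P' u * (θ (b u) - 1) ≤ -(1 / 4) := by
        simp only [mul_sub, mul_one, Finset.sum_sub_distrib, hP's]; linarith
      nlinarith
    · rw [ind_false h]; positivity
  -- Hash values at distinct points are independent, so only the diagonal contributes to the
  -- variance.
  have hcov : ∀ u u' : α, 𝔼 b : α → β, (θ (b u) - 1) * (θ (b u') - 1)
      = if u = u' then F - 1 else 0 := by
    intro u u'
    split_ifs with h
    · subst h
      rw [expect_eval u fun y => (θ y - 1) * (θ y - 1)]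
      have : ∀ y, (θ y - 1) * (θ y - 1) = θ y ^ 2 - θ y - θ y + 1 := fun y => by ring
      simp only [this, Finset.expect_add_distrib, Finset.expect_sub_distrib, hθ1, hθ2]
      simp
    · rw [expect_eval_mul h (fun y => θ y - 1) fun y => θ y - 1, Finset.expect_sub_distrib, hθ1]
      simp
  have hvar : 𝔼 b : α → β, (∑ u, P' u * (θ (b u) - 1)) ^ 2 ≤ (F - 1) * c := by
    have h1 : ∀ b : α → β, (∑ u, P' u * (θ (b u) - 1)) ^ 2
        = ∑ u, ∑ u', P' u * P' u' * ((θ (b u) - 1) * (θ (b u') - 1)) := by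
      intro b
      rw [sq, Finset.sum_mul_sum]
      refine Finset.sum_congr rfl fun u _ => Finset.sum_congr rfl fun u' _ => by ring
    simp only [h1, Finset.expect_sum_comm, ← Finset.mul_expect, hcov]
    simp only [mul_ite, mul_zero, Finset.sum_ite_eq, Finset.mem_univ, if_true]
    calc ∑ u, P' u * P' u * (F - 1) ≤ ∑ u, P u * (c * (F - 1)) := by
          refine Finset.sum_le_sum fun u _ => ?_
          rw [mul_assoc]
          exact mul_le_mul (hP'P u) (mul_le_mul_of_nonneg_right (hP'c u) (by linarith))
            (mul_nonneg (hP'0 u) (by linarith)) (hP u)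
      _ = (F - 1) * c := by rw [← Finset.sum_mul, hP1]; ring
  calc 𝔼 b : α → β, ind (∑ u, P u * θ (b u) < 1 / 2)
      ≤ 𝔼 b : α → β, 16 * (∑ u, P' u * (θ (b u) - 1)) ^ 2 :=
        Finset.expect_le_expect fun b _ => hpt b
    _ = 16 * 𝔼 b : α → β, (∑ u, P' u * (θ (b u) - 1)) ^ 2 := by rw [Finset.mul_expect]
    _ ≤ _ := by linarith

end RandomHash

/-! ### Replacing randomised encoders by deterministic ones. -/

section Selection

/-- The minimiser of `φ` works: its value is at most twice the weighted sum once the total weight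
reaches 1/2, and otherwise the trivial bound `C` applies. The weights are not normalised because
they will be a channel restricted to the frozen bin, whose total mass is only controlled from below.
-/
theorem exists_le_of_weights {B : Type*} [Fintype B] [Nonempty B] {w φ : B → ℝ} {C : ℝ}
    (hw : ∀ b, 0 ≤ w b) (hφ : ∀ b, 0 ≤ φ b) (hφC : ∀ b, φ b ≤ C) :
    ∃ b, φ b ≤ 2 * ∑ b, w b * φ b + C * ind (∑ b, w b < 1 / 2) := by
  obtain ⟨b, -, hb⟩ := Finset.exists_min_image Finset.univ φ Finset.univ_nonempty
  refine ⟨b, ?_⟩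
  have hs : 0 ≤ ∑ b, w b * φ b := Finset.sum_nonneg fun b _ => mul_nonneg (hw b) (hφ b)
  by_cases h : ∑ b, w b < 1 / 2
  · rw [ind_true h]; linarith [hφC b]
  · rw [ind_false h]
    push Not at h
    have : (∑ b, w b) * φ b ≤ ∑ b, w b * φ b := by
      rw [Finset.sum_mul]
      exact Finset.sum_le_sum fun b' _ =>
        mul_le_mul_of_nonneg_left (hb b' (Finset.mem_univ _)) (hw b')
    nlinarith [hφ b]

/-- Derandomisation of an encoder that sees only `π s`. -/
theorem exists_encoder {S A B : Type*} [Fintype S] [Fintype B] [Nonempty B] (π : S → A)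
    {Q : S → ℝ} (hQ : ∀ s, 0 ≤ Q s) {w : A → B → ℝ} (hw : ∀ a b, 0 ≤ w a b)
    {err : S → B → ℝ} (h0 : ∀ s b, 0 ≤ err s b) (h1 : ∀ s b, err s b ≤ 1) :
    ∃ g : A → B, ∑ s, Q s * err s (g (π s))
      ≤ ∑ s, Q s * (2 * ∑ b, w (π s) b * err s b + ind (∑ b, w (π s) b < 1 / 2)) := by
  classical
  -- The encoder cannot distinguish blocks with the same observation `a`, so one choice is made per
  -- fibre, against the error accumulated over that fibre.
  have key : ∀ a, ∃ b, ∑ s with π s = a, Q s * err s b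
      ≤ 2 * ∑ b, w a b * (∑ s with π s = a, Q s * err s b)
        + (∑ s with π s = a, Q s) * ind (∑ b, w a b < 1 / 2) := fun a =>
    exists_le_of_weights (hw a)
      (fun b => Finset.sum_nonneg fun s _ => mul_nonneg (hQ s) (h0 s b))
      fun b => Finset.sum_le_sum fun s _ => mul_le_of_le_one_right (hQ s) (h1 s b)
  choose g hg using key
  refine ⟨g, ?_⟩
  have hI : ∀ f : S → ℝ, ∑ s, f s = ∑ a ∈ Finset.univ.image π, ∑ s with π s = a, f s := fun f =>
    (Finset.sum_fiberwise_of_maps_to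
      (fun s _ => Finset.mem_image_of_mem π (Finset.mem_univ s)) f).symm
  rw [hI, hI]
  refine Finset.sum_le_sum fun a _ => ?_
  calc ∑ s with π s = a, Q s * err s (g (π s)) = ∑ s with π s = a, Q s * err s (g a) :=
        Finset.sum_congr rfl fun s hs => by rw [(Finset.mem_filter.1 hs).2]
    _ ≤ _ := hg a
    _ = ∑ s with π s = a, Q s * (2 * ∑ b, w a b * err s b + ind (∑ b, w a b < 1 / 2)) := by
        simp only [mul_add, Finset.sum_add_distrib, ← Finset.sum_mul, Finset.mul_sum]
        rw [Finset.sum_comm]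
        congr 1
        refine Finset.sum_congr rfl fun s _ => Finset.sum_congr rfl fun b _ => by ring
    _ = _ := Finset.sum_congr rfl fun s hs => by rw [(Finset.mem_filter.1 hs).2]

end Selection

/-! ### One-shot coding: hashed encoders, list decoders and the expected failure. -/

section OneShot

/-- Density of the event that the first component of a uniform hash value is zero. -/
noncomputable def hashDensity (F M : ℕ) [NeZero F] (y : Fin F × Fin M) : ℝ :=
  if y.1 = 0 then F else 0

theorem hashDensity_nonneg (F M : ℕ) [NeZero F] (y : Fin F × Fin M) : 0 ≤ hashDensity F M y := by
  unfold hashDensity; split_ifs <;> positivity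

theorem expect_hashDensity (F M : ℕ) [NeZero F] [NeZero M] : 𝔼 y, hashDensity F M y = 1 := by
  have hF : (F : ℝ) ≠ 0 := NeZero.ne _
  have hM : (M : ℝ) ≠ 0 := NeZero.ne _
  rw [Fintype.expect_eq_sum_div_card, Fintype.sum_prod_type_right]
  simp only [hashDensity, Finset.sum_const, Finset.card_univ, Fintype.card_fin, Fintype.card_prod,
    nsmul_eq_mul, Finset.sum_ite_eq', Finset.mem_univ, if_true]
  push_cast
  field_simp

theorem expect_hashDensity_sq (F M : ℕ) [NeZero F] [NeZero M] :
    𝔼 y, hashDensity F M y ^ 2 = F := by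
  have : ∀ y : Fin F × Fin M, hashDensity F M y ^ 2 = F * hashDensity F M y := by
    intro y; unfold hashDensity; split_ifs <;> ring
  simp only [this]
  rw [← Finset.mul_expect, expect_hashDensity, mul_one]

variable {S A₁ A₂ A₃ U V : Type*} [Fintype S] [Fintype U] [Fintype V]
  {F₁ M₁ F₂ M₂ : ℕ} [NeZero F₁] [NeZero F₂]

/-- The pair `w` of descriptions is accepted by both hashes, is good for the source, and is
recovered without ambiguity by the second encoder (list `l₁`) and the decoder (list `l`). -/
def Succeeds (b₁ : U → Fin F₁ × Fin M₁) (b₂ : U × V → Fin F₂ × Fin M₂) (l₁ : Finset U)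
    (l : Finset (U × V)) (G : Set (U × V)) (w : U × V) : Prop :=
  (b₁ w.1).1 = 0 ∧ (b₂ w).1 = 0 ∧ (w ∈ G ∧ w.1 ∈ l₁ ∧ w ∈ l) ∧
    (∀ u ∈ l₁, b₁ u = b₁ w.1 → u = w.1) ∧ ∀ x ∈ l, b₁ x.1 = b₁ w.1 → b₂ x = b₂ w → x = w

/-- Bound on the failure probability for fixed hashes and a fixed source block. -/
noncomputable def hashedError (b₁ : U → Fin F₁ × Fin M₁) (b₂ : U × V → Fin F₂ × Fin M₂)
    (P₁ : U → ℝ) (P₂ : U → V → ℝ) (l₁ : Finset U) (l : Finset (U × V)) (G : Set (U × V)) : ℝ :=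
  2 * ∑ u, P₁ u * hashDensity F₁ M₁ (b₁ u) *
      (2 * ∑ v, P₂ u v * hashDensity F₂ M₂ (b₂ (u, v)) * ind (¬Succeeds b₁ b₂ l₁ l G (u, v))
        + ind (∑ v, P₂ u v * hashDensity F₂ M₂ (b₂ (u, v)) < 1 / 2))
    + ind (∑ u, P₁ u * hashDensity F₁ M₁ (b₁ u) < 1 / 2)

/-- The two encoders are derandomised in reverse order, each costing one factor 2 and one small-mass
term; this produces the nested shape of `hashedError`. -/
theorem exists_code_of_hash [Nonempty U] [Nonempty V] (π₁ : S → A₁) (π₂ : S → A₂) (π₃ : S → A₃)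
    {Q : S → ℝ} (hQ : ∀ s, 0 ≤ Q s) {W₁ : A₁ → U → ℝ} (hW₁ : ∀ a u, 0 ≤ W₁ a u)
    {W₂ : U → A₂ → V → ℝ} (hW₂ : ∀ u a v, 0 ≤ W₂ u a v)
    (L₁ : A₂ → Finset U) (L : A₃ → Finset (U × V)) (G : S → Set (U × V))
    (b₁ : U → Fin F₁ × Fin M₁) (b₂ : U × V → Fin F₂ × Fin M₂) :
    ∃ (e₁ : A₁ → Fin M₁) (e₂ : A₂ → Fin M₁ → Fin M₂) (d : A₃ → Fin M₁ → Fin M₂ → U × V),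
      ∑ s, Q s * ind (d (π₃ s) (e₁ (π₁ s)) (e₂ (π₂ s) (e₁ (π₁ s))) ∉ G s)
        ≤ ∑ s, Q s * hashedError b₁ b₂ (W₁ (π₁ s)) (fun u => W₂ u (π₂ s)) (L₁ (π₂ s)) (L (π₃ s))
            (G s) := by
  classical
  let err : S → U → V → ℝ := fun s u v =>
    ind (¬Succeeds b₁ b₂ (L₁ (π₂ s)) (L (π₃ s)) (G s) (u, v))
  let w₁ : A₁ → U → ℝ := fun a u => W₁ a u * hashDensity F₁ M₁ (b₁ u)
  let w₂ : U × A₂ → V → ℝ := fun x v => W₂ x.1 x.2 v * hashDensity F₂ M₂ (b₂ (x.1, v))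
  have hw₁ : ∀ a u, 0 ≤ w₁ a u := fun a u => mul_nonneg (hW₁ a u) (hashDensity_nonneg _ _ _)
  have hw₂ : ∀ x v, 0 ≤ w₂ x v := fun x v => mul_nonneg (hW₂ _ _ v) (hashDensity_nonneg _ _ _)
  -- Encoder 2 is chosen as if it were told `u`, with `u` still random and made part of the source.
  -- It really sees only the message; the event `Succeeds` makes its decoded guess equal to `u`.
  obtain ⟨g₂, hg₂⟩ := exists_encoder (S := S × U) (fun x => (x.2, π₂ x.1))
    (Q := fun x => Q x.1 * w₁ (π₁ x.1) x.2) (fun x => mul_nonneg (hQ _) (hw₁ _ _)) hw₂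
    (err := fun x v => err x.1 x.2 v) (fun _ _ => ind_nonneg _) (fun _ _ => ind_le_one _)
  obtain ⟨g₁, hg₁⟩ := exists_encoder π₁ hQ hw₁ (err := fun s u => err s u (g₂ (u, π₂ s)))
    (fun _ _ => ind_nonneg _) (fun _ _ => ind_le_one _)
  -- Any list element with frozen index 0 and the received message is taken; uniqueness is part of
  -- `Succeeds`, and the default value occurs only in failure.
  let dec₁ : A₂ → Fin M₁ → U := fun a m =>
    if h : ∃ u ∈ L₁ a, b₁ u = (0, m) then h.choose else Classical.arbitrary U
  let d : A₃ → Fin M₁ → Fin M₂ → U × V := fun a m m' =>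
    if h : ∃ x ∈ L a, b₁ x.1 = (0, m) ∧ b₂ x = (0, m') then h.choose else Classical.arbitrary _
  refine ⟨fun a => (b₁ (g₁ a)).2, fun a m => (b₂ (dec₁ a m, g₂ (dec₁ a m, a))).2, d, ?_⟩
  have hle : ∀ s, ind (d (π₃ s) (b₁ (g₁ (π₁ s))).2
      (b₂ (dec₁ (π₂ s) (b₁ (g₁ (π₁ s))).2, g₂ (dec₁ (π₂ s) (b₁ (g₁ (π₁ s))).2, π₂ s))).2 ∉ G s)
      ≤ err s (g₁ (π₁ s)) (g₂ (g₁ (π₁ s), π₂ s)) := by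
    intro s
    refine ind_le_ind fun hbad hs => hbad ?_
    set u := g₁ (π₁ s)
    obtain ⟨h1, h2, ⟨hG, hl₁, hl⟩, hu₁, hu⟩ := hs
    have e1 : b₁ u = (0, (b₁ u).2) := Prod.ext h1 rfl
    have hd : dec₁ (π₂ s) (b₁ u).2 = u := by
      have h : ∃ u' ∈ L₁ (π₂ s), b₁ u' = (0, (b₁ u).2) := ⟨u, hl₁, e1⟩
      simp only [dec₁, dif_pos h]
      exact hu₁ _ h.choose_spec.1 (h.choose_spec.2.trans e1.symm)
    rw [hd]
    set v := g₂ (u, π₂ s)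
    have e2 : b₂ (u, v) = (0, (b₂ (u, v)).2) := Prod.ext h2 rfl
    have h : ∃ x ∈ L (π₃ s), b₁ x.1 = (0, (b₁ u).2) ∧ b₂ x = (0, (b₂ (u, v)).2) :=
      ⟨(u, v), hl, e1, e2⟩
    have hdd : d (π₃ s) (b₁ u).2 (b₂ (u, v)).2 = (u, v) := by
      simp only [d, dif_pos h]
      exact hu _ h.choose_spec.1 (h.choose_spec.2.1.trans e1.symm)
        (h.choose_spec.2.2.trans e2.symm)
    rw [hdd]
    exact hG
  refine (Finset.sum_le_sum fun s _ => mul_le_mul_of_nonneg_left (hle s) (hQ s)).trans ?_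
  refine hg₁.trans ?_
  simp only [Fintype.sum_prod_type] at hg₂
  have e : ∀ s, Q s * (2 * ∑ u, w₁ (π₁ s) u * err s u (g₂ (u, π₂ s))
        + ind (∑ u, w₁ (π₁ s) u < 1 / 2))
      = 2 * (∑ u, Q s * w₁ (π₁ s) u * err s u (g₂ (u, π₂ s)))
        + Q s * ind (∑ u, w₁ (π₁ s) u < 1 / 2) := by
    intro s
    simp only [mul_assoc, ← Finset.mul_sum]; ring
  have e' : ∀ s, Q s * hashedError b₁ b₂ (W₁ (π₁ s)) (fun u => W₂ u (π₂ s)) (L₁ (π₂ s)) (L (π₃ s))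
            (G s) = 2 * (∑ u, Q s * w₁ (π₁ s) u * (2 * ∑ v, w₂ (u, π₂ s) v * err s u v
              + ind (∑ v, w₂ (u, π₂ s) v < 1 / 2))) + Q s * ind (∑ u, w₁ (π₁ s) u < 1 / 2) := by
    intro s
    simp only [mul_assoc (Q s), ← Finset.mul_sum, hashedError]
    ring
  simp only [e, e', Finset.sum_add_distrib, ← Finset.mul_sum]
  simp only [mul_assoc, ← Finset.mul_sum] at hg₂ ⊢
  linarith

variable [DecidableEq U] [DecidableEq V] [NeZero M₁] [NeZero M₂]

/-- Union bound over four causes: the pair is bad or unlisted; encoder 2 sees a colliding first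
block; the decoder confuses it with a pair having the same first block; the decoder confuses it with
a pair having another first block. In the last case both hashes must collide, which gives the
product of the two hash sizes and hence the sum-rate condition. -/
theorem expect_hashed_failure {l₁ : Finset U} {l : Finset (U × V)} {G : Set (U × V)} {K₁ K₂ K : ℝ}
    (hK₁ : (l₁.card : ℝ) ≤ K₁) (hK : (l.card : ℝ) ≤ K) (u : U) (v : V)
    (hK₂ : ((l.filter fun x => x.1 = u).card : ℝ) ≤ K₂) :
    𝔼 b₁ : U → Fin F₁ × Fin M₁, 𝔼 b₂ : U × V → Fin F₂ × Fin M₂,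
      hashDensity F₁ M₁ (b₁ u) * (hashDensity F₂ M₂ (b₂ (u, v)) *
        ind (¬Succeeds b₁ b₂ l₁ l G (u, v)))
      ≤ ind (¬((u, v) ∈ G ∧ u ∈ l₁ ∧ (u, v) ∈ l)) + K₁ / (F₁ * M₁) + K₂ / (F₂ * M₂)
        + K / (F₁ * M₁ * (F₂ * M₂)) := by
  set θ₁ := hashDensity F₁ M₁
  set θ₂ := hashDensity F₂ M₂
  set B := ind (¬((u, v) ∈ G ∧ u ∈ l₁ ∧ (u, v) ∈ l))
  have hpt : ∀ (b₁ : U → Fin F₁ × Fin M₁) (b₂ : U × V → Fin F₂ × Fin M₂),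
      θ₁ (b₁ u) * (θ₂ (b₂ (u, v)) * ind (¬Succeeds b₁ b₂ l₁ l G (u, v)))
      ≤ θ₁ (b₁ u) * θ₂ (b₂ (u, v)) * B
        + ∑ u' ∈ l₁.filter (· ≠ u), θ₁ (b₁ u) * ind (b₁ u' = b₁ u) * θ₂ (b₂ (u, v))
        + ∑ x ∈ l.filter (fun x => x.1 = u ∧ x ≠ (u, v)),
            θ₁ (b₁ u) * (θ₂ (b₂ (u, v)) * ind (b₂ x = b₂ (u, v)))
        + ∑ x ∈ l.filter (fun x => x.1 ≠ u),
            θ₁ (b₁ u) * ind (b₁ x.1 = b₁ u) * (θ₂ (b₂ (u, v)) * ind (b₂ x = b₂ (u, v))) := by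
    intro b₁ b₂
    have t1 : 0 ≤ θ₁ (b₁ u) := hashDensity_nonneg _ _ _
    have t2 : 0 ≤ θ₂ (b₂ (u, v)) := hashDensity_nonneg _ _ _
    have n1 : 0 ≤ θ₁ (b₁ u) * θ₂ (b₂ (u, v)) * B := mul_nonneg (mul_nonneg t1 t2) (ind_nonneg _)
    have n2 : ∀ u' ∈ l₁.filter (· ≠ u), 0 ≤ θ₁ (b₁ u) * ind (b₁ u' = b₁ u) * θ₂ (b₂ (u, v)) :=
      fun u' _ => mul_nonneg (mul_nonneg t1 (ind_nonneg _)) t2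
    have n3 : ∀ x ∈ l.filter (fun x => x.1 = u ∧ x ≠ (u, v)),
        0 ≤ θ₁ (b₁ u) * (θ₂ (b₂ (u, v)) * ind (b₂ x = b₂ (u, v))) :=
      fun x _ => mul_nonneg t1 (mul_nonneg t2 (ind_nonneg _))
    have n4 : ∀ x ∈ l.filter (fun x => x.1 ≠ u),
        0 ≤ θ₁ (b₁ u) * ind (b₁ x.1 = b₁ u) * (θ₂ (b₂ (u, v)) * ind (b₂ x = b₂ (u, v))) :=
      fun x _ => mul_nonneg (mul_nonneg t1 (ind_nonneg _)) (mul_nonneg t2 (ind_nonneg _))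
    have m2 := Finset.sum_nonneg n2
    have m3 := Finset.sum_nonneg n3
    have m4 := Finset.sum_nonneg n4
    by_cases hs : Succeeds b₁ b₂ l₁ l G (u, v)
    · rw [ind_false (not_not.2 hs)]; linarith
    rw [ind_true hs, mul_one]
    by_cases z1 : (b₁ u).1 = 0
    swap
    · have : θ₁ (b₁ u) = 0 := if_neg z1
      simp [this]
    by_cases z2 : (b₂ (u, v)).1 = 0
    swap
    · have : θ₂ (b₂ (u, v)) = 0 := if_neg z2
      simp [this]
    by_cases hG : (u, v) ∈ G ∧ u ∈ l₁ ∧ (u, v) ∈ l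
    swap
    · have : B = 1 := ind_true hG
      rw [this] at n1 ⊢; linarith
    by_cases h1 : ∀ u' ∈ l₁, b₁ u' = b₁ u → u' = u
    swap
    · push Not at h1
      obtain ⟨u', hu', e, hne⟩ := h1
      have := Finset.single_le_sum n2 (Finset.mem_filter.2 ⟨hu', hne⟩)
      rw [ind_true e] at this; linarith
    by_cases h2 : ∀ x ∈ l, b₁ x.1 = b₁ u → b₂ x = b₂ (u, v) → x = (u, v)
    · exact absurd ⟨z1, z2, hG, h1, h2⟩ hs
    push Not at h2
    obtain ⟨x, hx, e1, e2, hne⟩ := h2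
    by_cases hxu : x.1 = u
    · have := Finset.single_le_sum n3 (Finset.mem_filter.2 ⟨hx, hxu, hne⟩)
      rw [ind_true e2] at this; linarith
    · have := Finset.single_le_sum n4 (Finset.mem_filter.2 ⟨hx, hxu⟩)
      rw [ind_true e1, ind_true e2] at this; linarith
  refine (Finset.expect_le_expect fun b₁ _ =>
    Finset.expect_le_expect fun b₂ _ => hpt b₁ b₂).trans ?_
  have E1 : 𝔼 b : U → Fin F₁ × Fin M₁, θ₁ (b u) = 1 := by
    rw [expect_eval, expect_hashDensity]
  have E2 : 𝔼 b : U × V → Fin F₂ × Fin M₂, θ₂ (b (u, v)) = 1 := by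
    rw [expect_eval, expect_hashDensity]
  have C1 : ∀ u', u' ≠ u → 𝔼 b : U → Fin F₁ × Fin M₁, θ₁ (b u) * ind (b u' = b u)
      = 1 / (F₁ * M₁) := fun u' h => by
    rw [expect_collision h.symm (expect_hashDensity _ _)]; simp
  have C2 : ∀ x, x ≠ (u, v) → 𝔼 b : U × V → Fin F₂ × Fin M₂, θ₂ (b (u, v)) * ind (b x = b (u, v))
      = 1 / (F₂ * M₂) := fun x h => by
    rw [expect_collision h.symm (expect_hashDensity _ _)]; simp
  simp only [Finset.expect_add_distrib, Finset.expect_sum_comm]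
  refine add_le_add (add_le_add (add_le_add ?_ ?_) ?_) ?_
  · simp only [← Finset.expect_mul, ← Finset.mul_expect, E1, E2]; simp
  · have : ∀ u' ∈ l₁.filter (· ≠ u), 𝔼 b₁ : U → Fin F₁ × Fin M₁,
        𝔼 b₂ : U × V → Fin F₂ × Fin M₂, θ₁ (b₁ u) * ind (b₁ u' = b₁ u) * θ₂ (b₂ (u, v))
        = 1 / (F₁ * M₁) := by
      intro u' hu'
      simp only [← Finset.mul_expect, E2, mul_one]
      exact C1 u' (Finset.mem_filter.1 hu').2
    rw [Finset.sum_congr rfl this, Finset.sum_const, nsmul_eq_mul, mul_one_div]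
    gcongr
    exact le_trans (by exact_mod_cast Finset.card_filter_le _ _) hK₁
  · have : ∀ x ∈ l.filter (fun x => x.1 = u ∧ x ≠ (u, v)), 𝔼 b₁ : U → Fin F₁ × Fin M₁,
        𝔼 b₂ : U × V → Fin F₂ × Fin M₂, θ₁ (b₁ u) * (θ₂ (b₂ (u, v)) * ind (b₂ x = b₂ (u, v)))
        = 1 / (F₂ * M₂) := by
      intro x hx
      simp only [← Finset.mul_expect, ← Finset.expect_mul, E1, one_mul]
      exact C2 x (Finset.mem_filter.1 hx).2.2
    rw [Finset.sum_congr rfl this, Finset.sum_const, nsmul_eq_mul, mul_one_div]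
    gcongr
    refine le_trans ?_ hK₂
    exact_mod_cast Finset.card_le_card fun x hx => by
      rw [Finset.mem_filter] at hx ⊢; exact ⟨hx.1, hx.2.1⟩
  · have : ∀ x ∈ l.filter (fun x => x.1 ≠ u), 𝔼 b₁ : U → Fin F₁ × Fin M₁,
        𝔼 b₂ : U × V → Fin F₂ × Fin M₂, θ₁ (b₁ u) * ind (b₁ x.1 = b₁ u) *
          (θ₂ (b₂ (u, v)) * ind (b₂ x = b₂ (u, v))) = 1 / (F₁ * M₁ * (F₂ * M₂)) := by
      intro x hx
      have hx' := (Finset.mem_filter.1 hx).2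
      simp only [← Finset.mul_expect, ← Finset.expect_mul, C1 x.1 hx',
        C2 x fun h => hx' (by rw [h])]
      rw [one_div_mul_one_div]
    rw [Finset.sum_congr rfl this, Finset.sum_const, nsmul_eq_mul, mul_one_div]
    gcongr
    exact le_trans (by exact_mod_cast Finset.card_filter_le _ _) hK

theorem expect_hashedError_le {P₁ : U → ℝ} (hP₁ : ∀ u, 0 ≤ P₁ u) (hP₁1 : ∑ u, P₁ u = 1)
    {P₂ : U → V → ℝ} (hP₂ : ∀ u v, 0 ≤ P₂ u v) (hP₂1 : ∀ u, ∑ v, P₂ u v = 1)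
    {l₁ : Finset U} {l : Finset (U × V)} {G : Set (U × V)} {K₁ K₂ K c₁ c₂ : ℝ}
    (hK₁ : (l₁.card : ℝ) ≤ K₁) (hK : (l.card : ℝ) ≤ K)
    (hK₂ : ∀ u, ((l.filter fun x => x.1 = u).card : ℝ) ≤ K₂) (hc₁ : 0 ≤ c₁) (hc₂ : 0 ≤ c₂) :
    𝔼 b₁ : U → Fin F₁ × Fin M₁, 𝔼 b₂ : U × V → Fin F₂ × Fin M₂,
      hashedError b₁ b₂ P₁ P₂ l₁ l G
      ≤ 16 * ((F₁ - 1) * c₁) + 4 * ∑ u, P₁ u * ind (c₁ < P₁ u)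
        + 2 * (16 * ((F₂ - 1) * c₂) + 4 * ∑ u, ∑ v, P₁ u * P₂ u v * ind (c₂ < P₂ u v))
        + 4 * (∑ u, ∑ v, P₁ u * P₂ u v * ind (¬((u, v) ∈ G ∧ u ∈ l₁ ∧ (u, v) ∈ l))
          + K₁ / (F₁ * M₁) + K₂ / (F₂ * M₂) + K / (F₁ * M₁ * (F₂ * M₂))) := by
  have hF₁ : (1 : ℝ) ≤ F₁ := by exact_mod_cast NeZero.one_le
  have hF₂ : (1 : ℝ) ≤ F₂ := by exact_mod_cast NeZero.one_le
  have E1 : ∀ u, 𝔼 b : U → Fin F₁ × Fin M₁, hashDensity F₁ M₁ (b u) = 1 := fun u => by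
    rw [expect_eval, expect_hashDensity]
  have hA : 𝔼 b : U → Fin F₁ × Fin M₁, ind (∑ u, P₁ u * hashDensity F₁ M₁ (b u) < 1 / 2)
      ≤ 16 * ((F₁ - 1) * c₁) + 4 * ∑ u, P₁ u * ind (c₁ < P₁ u) :=
    expect_mass_lt_half_le hP₁ hP₁1 (hashDensity_nonneg _ _) (expect_hashDensity _ _) hF₁
      (expect_hashDensity_sq _ _) hc₁
  have hB : ∀ u, 𝔼 b : U × V → Fin F₂ × Fin M₂,
      ind (∑ v, P₂ u v * hashDensity F₂ M₂ (b (u, v)) < 1 / 2)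
      ≤ 16 * ((F₂ - 1) * c₂) + 4 * ∑ v, P₂ u v * ind (c₂ < P₂ u v) := by
    intro u
    -- The second hash acts on pairs, so the conditional law is placed on the fibre over `u`.
    have key := expect_mass_lt_half_le (α := U × V) (P := fun x => if x.1 = u then P₂ u x.2 else 0)
      (fun x => by split_ifs; exacts [hP₂ _ _, le_rfl])
      (by rw [Fintype.sum_prod_type, Finset.sum_comm]; simp [hP₂1])
      (hashDensity_nonneg F₂ M₂) (expect_hashDensity _ _) hF₂
      (expect_hashDensity_sq _ _) hc₂
    have e : ∀ φ : U × V → ℝ, ∑ x : U × V, (if x.1 = u then P₂ u x.2 else 0) * φ x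
        = ∑ v, P₂ u v * φ (u, v) := by
      intro φ
      rw [Fintype.sum_prod_type, Finset.sum_comm]
      simp
    simp only [e] at key
    simpa using key
  have hC := fun u v => expect_hashed_failure (F₁ := F₁) (M₁ := M₁) (F₂ := F₂) (M₂ := M₂) (G := G)
    hK₁ hK u v (hK₂ u)
  have hsplit : 𝔼 b₁ : U → Fin F₁ × Fin M₁, 𝔼 b₂ : U × V → Fin F₂ × Fin M₂,
      hashedError b₁ b₂ P₁ P₂ l₁ l G
      = 4 * ∑ u, ∑ v, P₁ u * P₂ u v * (𝔼 b₁ : U → Fin F₁ × Fin M₁,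
          𝔼 b₂ : U × V → Fin F₂ × Fin M₂, hashDensity F₁ M₁ (b₁ u) *
            (hashDensity F₂ M₂ (b₂ (u, v)) * ind (¬Succeeds b₁ b₂ l₁ l G (u, v))))
        + 2 * ∑ u, P₁ u * (𝔼 b : U × V → Fin F₂ × Fin M₂,
          ind (∑ v, P₂ u v * hashDensity F₂ M₂ (b (u, v)) < 1 / 2))
        + 𝔼 b : U → Fin F₁ × Fin M₁, ind (∑ u, P₁ u * hashDensity F₁ M₁ (b u) < 1 / 2) := by
    have e : ∀ (b₁ : U → Fin F₁ × Fin M₁) (b₂ : U × V → Fin F₂ × Fin M₂),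
        hashedError b₁ b₂ P₁ P₂ l₁ l G
        = 4 * ∑ u, ∑ v, P₁ u * P₂ u v * (hashDensity F₁ M₁ (b₁ u) *
            (hashDensity F₂ M₂ (b₂ (u, v)) * ind (¬Succeeds b₁ b₂ l₁ l G (u, v))))
          + 2 * ∑ u, P₁ u * (hashDensity F₁ M₁ (b₁ u) *
            ind (∑ v, P₂ u v * hashDensity F₂ M₂ (b₂ (u, v)) < 1 / 2))
          + ind (∑ u, P₁ u * hashDensity F₁ M₁ (b₁ u) < 1 / 2) := by
      intro b₁ b₂
      unfold hashedError
      simp only [mul_add, Finset.sum_add_distrib, Finset.mul_sum]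
      congr 2
      · refine Finset.sum_congr rfl fun u _ => Finset.sum_congr rfl fun v _ => by ring
      · refine Finset.sum_congr rfl fun u _ => by ring
    simp only [e, Finset.expect_add_distrib, Finset.expect_sum_comm, ← Finset.mul_expect,
      ← Finset.expect_mul, E1, one_mul]
    simp
  rw [hsplit]
  have hsum2 : ∑ u, ∑ v, P₁ u * P₂ u v = 1 := by
    simp only [← Finset.mul_sum, hP₂1, mul_one, hP₁1]
  have h1 : ∑ u, ∑ v, P₁ u * P₂ u v * (𝔼 b₁ : U → Fin F₁ × Fin M₁,
          𝔼 b₂ : U × V → Fin F₂ × Fin M₂, hashDensity F₁ M₁ (b₁ u) *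
            (hashDensity F₂ M₂ (b₂ (u, v)) * ind (¬Succeeds b₁ b₂ l₁ l G (u, v))))
      ≤ ∑ u, ∑ v, P₁ u * P₂ u v * ind (¬((u, v) ∈ G ∧ u ∈ l₁ ∧ (u, v) ∈ l))
          + K₁ / (F₁ * M₁) + K₂ / (F₂ * M₂) + K / (F₁ * M₁ * (F₂ * M₂)) := by
    refine (Finset.sum_le_sum fun u _ => Finset.sum_le_sum fun v _ =>
      mul_le_mul_of_nonneg_left (hC u v) (mul_nonneg (hP₁ u) (hP₂ u v))).trans (le_of_eq ?_)
    simp only [mul_add, Finset.sum_add_distrib, ← Finset.sum_mul, hsum2, one_mul]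
  have h2 : ∑ u, P₁ u * (𝔼 b : U × V → Fin F₂ × Fin M₂,
          ind (∑ v, P₂ u v * hashDensity F₂ M₂ (b (u, v)) < 1 / 2))
      ≤ 16 * ((F₂ - 1) * c₂) + 4 * ∑ u, ∑ v, P₁ u * P₂ u v * ind (c₂ < P₂ u v) := by
    refine (Finset.sum_le_sum fun u _ => mul_le_mul_of_nonneg_left (hB u) (hP₁ u)).trans
      (le_of_eq ?_)
    simp only [mul_add, Finset.sum_add_distrib, ← Finset.sum_mul, hP₁1, one_mul, Finset.mul_sum]
    congr 1
    refine Finset.sum_congr rfl fun u _ => Finset.sum_congr rfl fun v _ => by ring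
  linarith

/-- One-shot achievability for cooperative coding with side information. -/
theorem exists_code [Nonempty U] [Nonempty V] (π₁ : S → A₁) (π₂ : S → A₂) (π₃ : S → A₃)
    {Q : S → ℝ} (hQ : ∀ s, 0 ≤ Q s) (hQ1 : ∑ s, Q s ≤ 1)
    {W₁ : A₁ → U → ℝ} (hW₁ : ∀ a u, 0 ≤ W₁ a u) (hW₁1 : ∀ a, ∑ u, W₁ a u = 1)
    {W₂ : U → A₂ → V → ℝ} (hW₂ : ∀ u a v, 0 ≤ W₂ u a v) (hW₂1 : ∀ u a, ∑ v, W₂ u a v = 1)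
    (L₁ : A₂ → Finset U) (L : A₃ → Finset (U × V)) (G : S → Set (U × V)) {K₁ K₂ K c₁ c₂ : ℝ}
    (hK₁ : ∀ a, ((L₁ a).card : ℝ) ≤ K₁) (hK : ∀ a, ((L a).card : ℝ) ≤ K)
    (hK₂ : ∀ a u, (((L a).filter fun x => x.1 = u).card : ℝ) ≤ K₂) (hc₁ : 0 ≤ c₁) (hc₂ : 0 ≤ c₂)
    {η₁ η₂ η₃ : ℝ} (hη₁ : ∀ s, Q s ≠ 0 → ∑ u, W₁ (π₁ s) u * ind (c₁ < W₁ (π₁ s) u) ≤ η₁)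
    (hη₂ : ∀ s, Q s ≠ 0 → ∑ u, ∑ v, W₁ (π₁ s) u * W₂ u (π₂ s) v * ind (c₂ < W₂ u (π₂ s) v) ≤ η₂)
    (hη₃ : ∀ s, Q s ≠ 0 → ∑ u, ∑ v, W₁ (π₁ s) u * W₂ u (π₂ s) v *
      ind (¬((u, v) ∈ G s ∧ u ∈ L₁ (π₂ s) ∧ (u, v) ∈ L (π₃ s))) ≤ η₃)
    {η : ℝ} (hη0 : 0 ≤ η)
    (hη : 16 * ((F₁ - 1) * c₁) + 4 * η₁ + 2 * (16 * ((F₂ - 1) * c₂) + 4 * η₂)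
        + 4 * (η₃ + K₁ / (F₁ * M₁) + K₂ / (F₂ * M₂) + K / (F₁ * M₁ * (F₂ * M₂))) ≤ η) :
    ∃ (e₁ : A₁ → Fin M₁) (e₂ : A₂ → Fin M₁ → Fin M₂) (d : A₃ → Fin M₁ → Fin M₂ → U × V),
      ∑ s, Q s * ind (d (π₃ s) (e₁ (π₁ s)) (e₂ (π₂ s) (e₁ (π₁ s))) ∉ G s) ≤ η := by
  -- The bound is averaged over the source as well, so that a single pair of hashes serves all
  -- source blocks. A total mass below 1 is allowed because `Q` will be a source law cut down to its
  -- typical blocks.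
  have havg : 𝔼 b₁ : U → Fin F₁ × Fin M₁, 𝔼 b₂ : U × V → Fin F₂ × Fin M₂,
      ∑ s, Q s * hashedError b₁ b₂ (W₁ (π₁ s)) (fun u => W₂ u (π₂ s)) (L₁ (π₂ s)) (L (π₃ s))
            (G s) ≤ η := by
    simp only [Finset.expect_sum_comm, ← Finset.mul_expect]
    calc _ ≤ ∑ s, Q s * η := Finset.sum_le_sum fun s _ => by
          by_cases h : Q s = 0
          · simp [h]
          refine mul_le_mul_of_nonneg_left ?_ (hQ s)
          refine (expect_hashedError_le (hW₁ _) (hW₁1 _) (fun u v => hW₂ u (π₂ s) v)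
            (fun u => hW₂1 u (π₂ s)) (hK₁ _) (hK _) (hK₂ _) hc₁ hc₂).trans ?_
          linarith [hη₁ s h, hη₂ s h, hη₃ s h]
      _ = (∑ s, Q s) * η := by rw [Finset.sum_mul]
      _ ≤ η := mul_le_of_le_one_left hη0 hQ1
  obtain ⟨b₁, -, hb₁⟩ := Finset.exists_le_of_expect_le Finset.univ_nonempty havg
  obtain ⟨b₂, -, hb₂⟩ := Finset.exists_le_of_expect_le Finset.univ_nonempty hb₁
  obtain ⟨e₁, e₂, d, h⟩ := exists_code_of_hash π₁ π₂ π₃ hQ hW₁ hW₂ L₁ L G b₁ b₂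
  exact ⟨e₁, e₂, d, h.trans hb₂⟩

end OneShot

/-! ### Chebyshev for product measures and a conditional law of large numbers. -/

section LargeNumbers

theorem sum_prod_apply {ι υ : Type*} [Fintype ι] [DecidableEq ι] [Fintype υ] (κ : ι → υ → ℝ) :
    ∑ u : ι → υ, ∏ t, κ t (u t) = ∏ t, ∑ y, κ t y := by
  rw [Finset.prod_univ_sum, Fintype.piFinset_univ]

theorem sum_prod_mul_sq {ι υ : Type*} [Fintype ι] [DecidableEq ι] [Fintype υ] {κ : ι → υ → ℝ}
    (hκ : ∀ t, ∑ y, κ t y = 1) {ψ : ι → υ → ℝ} (hψ : ∀ t, ∑ y, κ t y * ψ t y = 0) :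
    ∑ u : ι → υ, (∏ t, κ t (u t)) * (∑ t, ψ t (u t)) ^ 2 = ∑ t, ∑ y, κ t y * ψ t y ^ 2 := by
  -- Each product of two summands is absorbed into the product over `t`, so that the sum over `u`
  -- factorises coordinatewise.
  have h1 : ∀ u : ι → υ, (∏ t, κ t (u t)) * (∑ t, ψ t (u t)) ^ 2
      = ∑ i, ∑ j, ∏ t, κ t (u t) * ((if t = i then ψ t (u t) else 1) *
          (if t = j then ψ t (u t) else 1)) := by
    intro u
    simp only [Finset.prod_mul_distrib, Finset.prod_ite_eq', Finset.mem_univ, if_true]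
    rw [sq, Finset.sum_mul_sum, Finset.mul_sum]
    exact Finset.sum_congr rfl fun i _ => by rw [Finset.mul_sum]
  simp only [h1]
  rw [Finset.sum_comm]
  refine Finset.sum_congr rfl fun i _ => ?_
  rw [Finset.sum_comm]
  have h2 : ∀ j, ∑ u : ι → υ, ∏ t, κ t (u t) * ((if t = i then ψ t (u t) else 1) *
          (if t = j then ψ t (u t) else 1))
      = ∏ t, ∑ y, κ t y * ((if t = i then ψ t y else 1) * (if t = j then ψ t y else 1)) :=
    fun j => sum_prod_apply fun t y =>
      κ t y * ((if t = i then ψ t y else 1) * (if t = j then ψ t y else 1))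
  simp only [h2]
  rw [Finset.sum_eq_single_of_mem i (Finset.mem_univ i)]
  · rw [Finset.prod_eq_single_of_mem i (Finset.mem_univ i)]
    · simp [sq]
    · intro t _ ht; simp [ht, hκ]
  · intro j _ hj
    refine Finset.prod_eq_zero (Finset.mem_univ i) ?_
    simp [hj.symm, hψ]

theorem chebyshev_prod {ι υ : Type*} [Fintype ι] [DecidableEq ι] [Fintype υ] {κ : ι → υ → ℝ}
    (hκ0 : ∀ t y, 0 ≤ κ t y) (hκ : ∀ t, ∑ y, κ t y = 1) {φ : ι → υ → ℝ} {C : ℝ}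
    (hφ : ∀ t y, |φ t y| ≤ C) {τ : ℝ} (hτ : 0 < τ) :
    ∑ u : ι → υ, (∏ t, κ t (u t)) * ind (τ < |∑ t, φ t (u t) - ∑ t, ∑ y, κ t y * φ t y|)
      ≤ Fintype.card ι * C ^ 2 / τ ^ 2 := by
  set m : ι → ℝ := fun t => ∑ y, κ t y * φ t y with hm
  have hψ : ∀ t, ∑ y, κ t y * (φ t y - m t) = 0 := fun t => by
    simp only [mul_sub, Finset.sum_sub_distrib, ← Finset.sum_mul, hκ, one_mul]
    simp [hm]
  have hvar : ∀ t, ∑ y, κ t y * (φ t y - m t) ^ 2 ≤ C ^ 2 := by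
    intro t
    have : ∑ y, κ t y * (φ t y - m t) ^ 2 = ∑ y, κ t y * φ t y ^ 2 - m t ^ 2 := by
      have e : ∀ y, κ t y * (φ t y - m t) ^ 2
          = κ t y * φ t y ^ 2 - 2 * m t * (κ t y * φ t y) + κ t y * m t ^ 2 := fun y => by ring
      simp only [e, Finset.sum_add_distrib, Finset.sum_sub_distrib, ← Finset.mul_sum,
        ← Finset.sum_mul, hκ]
      simp only [hm]; ring
    rw [this]
    have h2 : ∑ y, κ t y * φ t y ^ 2 ≤ ∑ y, κ t y * C ^ 2 :=
      Finset.sum_le_sum fun y _ => mul_le_mul_of_nonneg_left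
        (sq_le_sq' (abs_le.1 (hφ t y)).1 (abs_le.1 (hφ t y)).2) (hκ0 t y)
    rw [← Finset.sum_mul, hκ, one_mul] at h2
    nlinarith [sq_nonneg (m t)]
  rw [le_div_iff₀ (by positivity), Finset.sum_mul]
  calc ∑ u : ι → υ, (∏ t, κ t (u t)) * ind (τ < |∑ t, φ t (u t) - ∑ t, m t|) * τ ^ 2
      ≤ ∑ u : ι → υ, (∏ t, κ t (u t)) * (∑ t, (φ t (u t) - m t)) ^ 2 := by
        refine Finset.sum_le_sum fun u _ => ?_
        rw [mul_assoc, Finset.sum_sub_distrib]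
        refine mul_le_mul_of_nonneg_left ?_ (Finset.prod_nonneg fun t _ => hκ0 t _)
        by_cases h : τ < |∑ t, φ t (u t) - ∑ t, m t|
        · rw [ind_true h, one_mul, ← sq_abs (∑ t, φ t (u t) - ∑ t, m t)]
          gcongr
        · rw [ind_false h, zero_mul]; positivity
    _ = ∑ t, ∑ y, κ t y * (φ t y - m t) ^ 2 :=
        sum_prod_mul_sq hκ (ψ := fun t y => φ t y - m t) hψ
    _ ≤ ∑ _t : ι, C ^ 2 := Finset.sum_le_sum fun t _ => hvar t
    _ = _ := by simp

theorem sum_apply_eq_occurrences {α : Type*} [Fintype α] {n : ℕ} (x : Fin n → α) (m : α → ℝ) :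
    ∑ t, m (x t) = ∑ a, (occurrences x a : ℝ) * m a := by
  classical
  rw [← Finset.sum_fiberwise Finset.univ x]
  refine Finset.sum_congr rfl fun a _ => ?_
  rw [Finset.sum_congr rfl fun t ht => by rw [(Finset.mem_filter.1 ht).2], Finset.sum_const,
    nsmul_eq_mul]
  unfold occurrences
  congr

theorem sum_occurrences {α : Type*} [Fintype α] {n : ℕ} (x : Fin n → α) :
    ∑ a, (occurrences x a : ℝ) = n := by
  have := sum_apply_eq_occurrences x fun _ => 1
  simpa using this.symm

theorem abs_average_sub_le {α : Type*} [Fintype α] {q : α → ℝ} (hq : q ∈ stdSimplex ℝ α)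
    {δ : ℝ} (hδ : 0 ≤ δ) {n : ℕ} (hn : n ≠ 0) {x : Fin n → α} (hx : x ∈ typicalSet q δ n)
    {m : α → ℝ} {C : ℝ} (hm : ∀ a, |m a| ≤ C) :
    |(∑ t, m (x t)) / n - ∑ a, q a * m a| ≤ 2 * C * δ := by
  classical
  have hn' : (n : ℝ) ≠ 0 := by exact_mod_cast hn
  set r : α → ℝ := fun a => (occurrences x a : ℝ) / n with hr
  have hr0 : ∀ a, 0 ≤ r a := fun a => by positivity
  have hr1 : ∑ a, r a = 1 := by
    rw [← Finset.sum_div, sum_occurrences, div_self hn']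
  have e : (∑ t, m (x t)) / n - ∑ a, q a * m a = ∑ a, (r a - q a) * m a := by
    rw [sum_apply_eq_occurrences, Finset.sum_div, ← Finset.sum_sub_distrib]
    exact Finset.sum_congr rfl fun a _ => by simp only [hr]; ring
  have hC : 0 ≤ C := by
    obtain ⟨a, -, -⟩ := Finset.exists_ne_zero_of_sum_ne_zero (by rw [hr1]; norm_num)
    exact (abs_nonneg _).trans (hm a)
  have hsupp : ∑ a with q a ≠ 0, |r a - q a| ≤ δ := by
    calc ∑ a with q a ≠ 0, |r a - q a| ≤ ∑ a with q a ≠ 0, δ / Fintype.card α :=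
          Finset.sum_le_sum fun a ha => hx a (Finset.mem_filter.1 ha).2
      _ ≤ ∑ _a : α, δ / Fintype.card α :=
          Finset.sum_le_sum_of_subset_of_nonneg (Finset.filter_subset _ _)
            fun _ _ _ => by positivity
      _ ≤ δ := by
          rw [Finset.sum_const, nsmul_eq_mul, Finset.card_univ]
          rcases eq_or_ne (Fintype.card α : ℝ) 0 with h | h
          · rw [h, zero_mul]; exact hδ
          · rw [mul_div_cancel₀ _ h]
  -- Typicality says nothing about letters outside the support of `q`. Since frequencies sum to 1,
  -- their total there equals the deficit on the support, which is at most `δ`.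
  have hoff : ∑ a with ¬q a ≠ 0, |r a - q a| ≤ δ := by
    have h1 : ∑ a with ¬q a ≠ 0, |r a - q a| = ∑ a with ¬q a ≠ 0, (r a - q a) := by
      refine Finset.sum_congr rfl fun a ha => abs_of_nonneg ?_
      have := not_not.1 (Finset.mem_filter.1 ha).2
      rw [this, sub_zero]; exact hr0 a
    have h2 : ∑ a with q a ≠ 0, (r a - q a) + ∑ a with ¬q a ≠ 0, (r a - q a) = 0 := by
      rw [Finset.sum_filter_add_sum_filter_not, Finset.sum_sub_distrib, hr1, hq.2, sub_self]
    have h3 := Finset.abs_sum_le_sum_abs (fun a => r a - q a) (Finset.univ.filter fun a => q a ≠ 0)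
    have h4 := neg_abs_le (∑ a with q a ≠ 0, (r a - q a))
    rw [h1]; linarith
  rw [e]
  calc |∑ a, (r a - q a) * m a| ≤ ∑ a, |(r a - q a) * m a| := Finset.abs_sum_le_sum_abs _ _
    _ ≤ ∑ a, |r a - q a| * C := Finset.sum_le_sum fun a _ => by
        rw [abs_mul]; exact mul_le_mul_of_nonneg_left (hm a) (abs_nonneg _)
    _ = (∑ a, |r a - q a|) * C := by rw [Finset.sum_mul]
    _ ≤ (2 * δ) * C := by
        refine mul_le_mul_of_nonneg_right ?_ hC
        rw [← Finset.sum_filter_add_sum_filter_not Finset.univ fun a => q a ≠ 0]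
        linarith
    _ = 2 * C * δ := by ring

/-- Conditional law of large numbers: uniformly over typical conditioning sequences and bounded
functions. -/
theorem conditional_lln {σ υ : Type*} [Fintype σ] [Fintype υ] {q : σ → ℝ}
    (hq : q ∈ stdSimplex ℝ σ) {κ : σ → υ → ℝ} (hκ0 : ∀ a y, 0 ≤ κ a y)
    (hκ : ∀ a, ∑ y, κ a y = 1) {C γ : ℝ} (hC : 0 < C) (hγ : 0 < γ) :
    ∃ δ : ℝ, 0 < δ ∧ ∃ n₀ : ℕ, ∀ n, n₀ < n → ∀ s ∈ typicalSet q δ n, ∀ φ : σ → υ → ℝ,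
      (∀ a y, |φ a y| ≤ C) →
      ∑ u : Fin n → υ, (∏ t, κ (s t) (u t)) *
        ind (γ < |(∑ t, φ (s t) (u t)) / n - ∑ a, q a * ∑ y, κ a y * φ a y|) ≤ γ := by
  -- The tolerance `γ` is split in two. This `δ` keeps the conditional mean within 2Cδ = γ/2 of its
  -- limit; Chebyshev at level nγ/2 gives 4C²/(nγ²), at most `γ` for these `n`. Neither choice
  -- depends on `φ`.
  refine ⟨γ / (4 * C), by positivity, ⌈4 * C ^ 2 / γ ^ 3⌉₊, fun n hn s hs φ hφ => ?_⟩
  have hn0 : (0 : ℝ) < n := by exact_mod_cast (Nat.zero_le _).trans_lt hn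
  have hnC : 4 * C ^ 2 / γ ^ 3 ≤ n := (Nat.le_ceil _).trans (by exact_mod_cast hn.le)
  have hm : ∀ a, |∑ y, κ a y * φ a y| ≤ C := by
    intro a
    calc |∑ y, κ a y * φ a y| ≤ ∑ y, |κ a y * φ a y| := Finset.abs_sum_le_sum_abs _ _
      _ ≤ ∑ y, κ a y * C := Finset.sum_le_sum fun y _ => by
          rw [abs_mul, abs_of_nonneg (hκ0 a y)]
          exact mul_le_mul_of_nonneg_left (hφ a y) (hκ0 a y)
      _ = C := by rw [← Finset.sum_mul, hκ, one_mul]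
  have hdev := abs_average_sub_le hq (δ := γ / (4 * C)) (by positivity)
    (by exact_mod_cast hn0.ne') hs hm
  have hdev' : 2 * C * (γ / (4 * C)) = γ / 2 := by field_simp; norm_num
  rw [hdev'] at hdev
  have hcheb := chebyshev_prod (fun t : Fin n => hκ0 (s t)) (fun t => hκ (s t))
    (fun t => hφ (s t)) (τ := n * (γ / 2)) (by positivity)
  calc _ ≤ ∑ u : Fin n → υ, (∏ t, κ (s t) (u t)) *
        ind (n * (γ / 2) < |∑ t, φ (s t) (u t) - ∑ t, ∑ y, κ (s t) y * φ (s t) y|) := by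
        refine Finset.sum_le_sum fun u _ => mul_le_mul_of_nonneg_left (ind_le_ind fun h => ?_)
          (Finset.prod_nonneg fun t _ => hκ0 _ _)
        have htri := abs_sub_le ((∑ t, φ (s t) (u t)) / n)
          ((∑ t, ∑ y, κ (s t) y * φ (s t) y) / n) (∑ a, q a * ∑ y, κ a y * φ a y)
        rw [← sub_div, abs_div, abs_of_pos hn0] at htri
        have : γ / 2 < |∑ t, φ (s t) (u t) - ∑ t, ∑ y, κ (s t) y * φ (s t) y| / n := by linarith
        rw [lt_div_iff₀ hn0] at this
        linarith
    _ ≤ _ := hcheb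
    _ ≤ γ := by
        rw [Fintype.card_fin, div_le_iff₀ (by positivity)]
        rw [div_le_iff₀ (by positivity)] at hnC
        have : (n : ℝ) * (4 * C ^ 2) ≤ n * (n * γ ^ 3) := mul_le_mul_of_nonneg_left hnC hn0.le
        nlinarith

theorem card_filter_exp_le {U : Type*} [Fintype U] {P : U → ℝ} (hP : ∀ u, 0 ≤ P u)
    (hP1 : ∑ u, P u ≤ 1) (x : ℝ) (s : Finset U) (hs : ∀ u ∈ s, Real.exp (-x) ≤ P u) :
    (s.card : ℝ) ≤ Real.exp x := by
  have : (s.card : ℝ) * Real.exp (-x) ≤ 1 := by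
    calc (s.card : ℝ) * Real.exp (-x) = ∑ _u ∈ s, Real.exp (-x) := by simp
      _ ≤ ∑ u ∈ s, P u := Finset.sum_le_sum hs
      _ ≤ ∑ u, P u := Finset.sum_le_sum_of_subset_of_nonneg (Finset.subset_univ _) fun u _ _ => hP u
      _ ≤ 1 := hP1
  rwa [Real.exp_neg, ← div_eq_mul_inv, div_le_one (Real.exp_pos _)] at this

end LargeNumbers

/-! ### Laws, conditional entropies, Markov chains and smoothed kernels. -/

section Entropy

variable {α β γ δ : Type*} [Fintype α] {p : α → ℝ}

theorem law_eq_sum_ind (p : α → ℝ) (f : α → β) (b : β) :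
    law p f b = ∑ a, p a * ind (f a = b) :=
  prob_eq_sum_ind p _

theorem law_nonneg (hp : ∀ a, 0 ≤ p a) (f : α → β) (b : β) : 0 ≤ law p f b := by
  rw [law_eq_sum_ind]
  exact Finset.sum_nonneg fun a _ => mul_nonneg (hp a) (ind_nonneg _)

theorem le_law (hp : ∀ a, 0 ≤ p a) (f : α → β) (a : α) : p a ≤ law p f (f a) := by
  rw [law_eq_sum_ind]
  have := Finset.single_le_sum (f := fun a' => p a' * ind (f a' = f a))
    (fun a' _ => mul_nonneg (hp a') (ind_nonneg _)) (Finset.mem_univ a)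
  simpa [ind_true] using this

theorem law_le_law (hp : ∀ a, 0 ≤ p a) {f : α → β} {g : α → γ} {b : β} {c : γ}
    (h : ∀ a, f a = b → g a = c) : law p f b ≤ law p g c := by
  rw [law_eq_sum_ind, law_eq_sum_ind]
  exact Finset.sum_le_sum fun a _ => mul_le_mul_of_nonneg_left (ind_le_ind (h a)) (hp a)

theorem sum_law_mul [Fintype β] (p : α → ℝ) (f : α → β) (F : β → ℝ) :
    ∑ b, law p f b * F b = ∑ a, p a * F (f a) := by
  simp only [law_eq_sum_ind, Finset.sum_mul]
  rw [Finset.sum_comm]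
  refine Finset.sum_congr rfl fun a _ => ?_
  rw [Finset.sum_eq_single_of_mem (f a) (Finset.mem_univ _)]
  · rw [ind_true rfl, mul_one]
  · intro b _ hb; rw [ind_false hb.symm]; ring

theorem sum_law [Fintype β] (p : α → ℝ) (f : α → β) : ∑ b, law p f b = ∑ a, p a := by
  simpa using sum_law_mul p f fun _ => 1

theorem law_comp [Fintype β] (p : α → ℝ) (f : α → β) (φ : β → γ) (c : γ) :
    law p (fun a => φ (f a)) c = ∑ b, law p f b * ind (φ b = c) := by
  rw [sum_law_mul, law_eq_sum_ind]

theorem law_congr {f : α → β} {g : α → γ} (h : ∀ a a', f a = f a' ↔ g a = g a') (a : α) :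
    law p f (f a) = law p g (g a) := by
  simp only [law_eq_sum_ind, h]

theorem law_apply_of_injective {f : α → β} (hf : Function.Injective f) (a : α) :
    law p f (f a) = p a := by
  rw [law_eq_sum_ind, Finset.sum_eq_single_of_mem a (Finset.mem_univ a), ind_true rfl, mul_one]
  intro a' _ h
  rw [ind_false fun h' => h (hf h'), mul_zero]

theorem entropy_eq_expectation [Fintype β] (p : α → ℝ) (f : α → β) :
    entropy p f = (∑ a, p a * -Real.log (law p f (f a))) / Real.log 2 := by
  rw [← sum_law_mul p f fun b => -Real.log (law p f b)]
  unfold entropy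
  congr 1
  exact Finset.sum_congr rfl fun b _ => by rw [Real.negMulLog]; ring

theorem entropy_congr [Fintype β] [Fintype γ] {f : α → β} {g : α → γ}
    (h : ∀ a a', f a = f a' ↔ g a = g a') : entropy p f = entropy p g := by
  rw [entropy_eq_expectation, entropy_eq_expectation]
  simp only [law_congr (p := p) h]

theorem IsMarkovChain.comp_right [Fintype δ] {ε : Type*} {f : α → β} {g : α → γ} {h : α → δ}
    [Fintype β] [Fintype γ] (hM : IsMarkovChain p f g h) (ψ : δ → ε) :
    IsMarkovChain p f g fun a => ψ (h a) := by
  classical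
  intro x y w
  have e1 : law p (fun a => (f a, g a, ψ (h a))) (x, y, w)
      = ∑ v, law p (fun a => (f a, g a, h a)) (x, y, v) * ind (ψ v = w) := by
    rw [law_comp p (fun a => (f a, g a, h a)) (fun b => (b.1, b.2.1, ψ b.2.2))]
    simp only [Fintype.sum_prod_type, Prod.mk.injEq]
    rw [Finset.sum_eq_single_of_mem x (Finset.mem_univ x),
      Finset.sum_eq_single_of_mem y (Finset.mem_univ y)]
    · simp
    · intro y' _ hy; simp [hy, ind]
    · intro x' _ hx; simp [hx, ind]
  have e2 : law p (fun a => (g a, ψ (h a))) (y, w)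
      = ∑ v, law p (fun a => (g a, h a)) (y, v) * ind (ψ v = w) := by
    rw [law_comp p (fun a => (g a, h a)) (fun b => (b.1, ψ b.2))]
    simp only [Fintype.sum_prod_type, Prod.mk.injEq]
    rw [Finset.sum_eq_single_of_mem y (Finset.mem_univ y)]
    · simp
    · intro y' _ hy; simp [hy, ind]
  rw [e1, e2, Finset.sum_mul, Finset.mul_sum]
  refine Finset.sum_congr rfl fun v _ => ?_
  rw [mul_right_comm, hM x y v, mul_assoc]

/-- The conditional probability of `f = b` given `g = d`, uniform where undefined. -/
noncomputable def condLaw [Fintype β] (p : α → ℝ) (f : α → β) (g : α → γ) (b : β) (d : γ) : ℝ :=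
  open Classical in
  if law p g d = 0 then 1 / Fintype.card β else law p (fun a => (f a, g a)) (b, d) / law p g d

/-- Conditional entropy `H(f | g)` in nats. -/
noncomputable def condEntropy [Fintype β] (p : α → ℝ) (f : α → β) (g : α → γ) : ℝ :=
  ∑ a, p a * -Real.log (condLaw p f g (f a) (g a))

theorem condLaw_nonneg [Fintype β] (hp : ∀ a, 0 ≤ p a) (f : α → β) (g : α → γ) (b : β) (d : γ) :
    0 ≤ condLaw p f g b d := by
  unfold condLaw
  split_ifs
  · positivity
  · exact div_nonneg (law_nonneg hp _ _) (law_nonneg hp _ _)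

theorem sum_law_pair [Fintype β] (p : α → ℝ) (f : α → β) (g : α → γ) (d : γ) :
    ∑ b, law p (fun a => (f a, g a)) (b, d) = law p g d := by
  simp only [law_eq_sum_ind]
  rw [Finset.sum_comm]
  refine Finset.sum_congr rfl fun a _ => ?_
  rw [Finset.sum_eq_single_of_mem (f a) (Finset.mem_univ _)]
  · simp
  · intro b _ hb; rw [ind_false fun h => hb (Prod.ext_iff.1 h).1.symm, mul_zero]

theorem sum_condLaw [Fintype β] [Nonempty β] (p : α → ℝ) (f : α → β) (g : α → γ) (d : γ) :
    ∑ b, condLaw p f g b d = 1 := by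
  unfold condLaw
  split_ifs with h
  · simp
  · rw [← Finset.sum_div, sum_law_pair, div_self h]

theorem condLaw_mul_law [Fintype β] (hp : ∀ a, 0 ≤ p a) (f : α → β) (g : α → γ) (b : β) (d : γ) :
    condLaw p f g b d * law p g d = law p (fun a => (f a, g a)) (b, d) := by
  unfold condLaw
  split_ifs with h
  · rw [h, mul_zero]
    refine le_antisymm (law_nonneg hp _ _) (h ▸ law_le_law hp fun a ha => (Prod.ext_iff.1 ha).2)
  · rw [div_mul_cancel₀ _ h]

theorem condLaw_pos [Fintype β] (hp : ∀ a, 0 ≤ p a) (f : α → β) (g : α → γ) {a : α} (ha : 0 < p a) :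
    0 < condLaw p f g (f a) (g a) := by
  have h1 : 0 < law p (fun a => (f a, g a)) (f a, g a) :=
    ha.trans_le (le_law hp (fun a => (f a, g a)) a)
  rw [← condLaw_mul_law hp] at h1
  exact pos_of_mul_pos_left h1 (law_nonneg hp _ _)

theorem condEntropy_eq [Fintype β] [Fintype γ] (hp : ∀ a, 0 ≤ p a) (f : α → β) (g : α → γ) :
    condEntropy p f g / Real.log 2 = entropy p (fun a => (f a, g a)) - entropy p g := by
  rw [entropy_eq_expectation, entropy_eq_expectation, ← sub_div, ← Finset.sum_sub_distrib,
    condEntropy]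
  congr 1
  refine Finset.sum_congr rfl fun a _ => ?_
  rcases (hp a).eq_or_lt with h | h
  · rw [← h]; ring
  · rw [← condLaw_mul_law hp, Real.log_mul (condLaw_pos hp f g h).ne'
      (h.trans_le (le_law hp g a)).ne']
    ring

theorem IsMarkovChain.law_eq [Fintype β] (hp : ∀ a, 0 ≤ p a) {f : α → β} {g : α → γ} {h : α → δ}
    (hM : IsMarkovChain p f g h) (x : β) (y : γ) (v : δ) :
    law p (fun a => (f a, g a, h a)) (x, y, v)
      = condLaw p f g x y * law p (fun a => (g a, h a)) (y, v) := by
  by_cases hy : law p g y = 0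
  · have h1 : law p (fun a => (f a, g a, h a)) (x, y, v) = 0 :=
      le_antisymm (hy ▸ law_le_law hp fun a ha => by simp_all) (law_nonneg hp _ _)
    have h2 : law p (fun a => (g a, h a)) (y, v) = 0 :=
      le_antisymm (hy ▸ law_le_law hp fun a ha => by simp_all) (law_nonneg hp _ _)
    rw [h1, h2, mul_zero]
  · apply mul_right_cancel₀ hy
    rw [hM x y v, ← condLaw_mul_law hp]; ring

theorem IsMarkovChain.entropy_add [Fintype β] [Fintype γ] [Fintype δ] (hp : ∀ a, 0 ≤ p a)
    {f : α → β} {g : α → γ} {h : α → δ} (hM : IsMarkovChain p f g h) :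
    entropy p (fun a => (f a, g a, h a))
      = condEntropy p f g / Real.log 2 + entropy p (fun a => (g a, h a)) := by
  rw [entropy_eq_expectation, entropy_eq_expectation p fun a => (g a, h a), condEntropy, ← add_div,
    ← Finset.sum_add_distrib]
  congr 1
  refine Finset.sum_congr rfl fun a _ => ?_
  rcases (hp a).eq_or_lt with h' | h'
  · rw [← h']; ring
  · rw [hM.law_eq hp, Real.log_mul (condLaw_pos hp f g h').ne'
      (h'.trans_le (le_law hp (fun a => (g a, h a)) a)).ne']
    ring

/-- Gibbs' inequality, from log x ≤ x - 1 applied to the likelihood ratio. It serves to make the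
rates nonnegative, so that rounding up a message set costs at most a factor 2. -/
theorem condMutualInfo_nonneg [Fintype β] [Fintype γ] [Fintype δ] (hp : p ∈ stdSimplex ℝ α)
    (f : α → β) (g : α → γ) (h : α → δ) : 0 ≤ condMutualInfo p f g h := by
  have hp0 : ∀ a, 0 ≤ p a := hp.1
  unfold condMutualInfo
  rw [entropy_eq_expectation, entropy_eq_expectation, entropy_eq_expectation,
    entropy_eq_expectation, ← add_div, ← sub_div, ← sub_div]
  refine div_nonneg ?_ (Real.log_nonneg (by norm_num))
  rw [← Finset.sum_add_distrib, ← Finset.sum_sub_distrib, ← Finset.sum_sub_distrib]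
  set A := law p fun a => (f a, h a)
  set B := law p fun a => (g a, h a)
  set T := law p fun a => (f a, g a, h a) with hT
  set D := law p h with hD
  have hA0 : ∀ x, 0 ≤ A x := law_nonneg hp0 _
  have hB0 : ∀ x, 0 ≤ B x := law_nonneg hp0 _
  have hT0 : ∀ x, 0 ≤ T x := law_nonneg hp0 _
  have hD0 : ∀ x, 0 ≤ D x := law_nonneg hp0 _
  have hpt : ∀ a, p a - p a * (A (f a, h a) * B (g a, h a) / (T (f a, g a, h a) * D (h a)))
      ≤ p a * -Real.log (A (f a, h a)) + p a * -Real.log (B (g a, h a))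
        - p a * -Real.log (T (f a, g a, h a)) - p a * -Real.log (D (h a)) := by
    intro a
    rcases (hp0 a).eq_or_lt with h' | h'
    · simp [← h']
    have pA : 0 < A (f a, h a) := h'.trans_le (le_law hp0 (fun a => (f a, h a)) a)
    have pB : 0 < B (g a, h a) := h'.trans_le (le_law hp0 (fun a => (g a, h a)) a)
    have pT : 0 < T (f a, g a, h a) := h'.trans_le (le_law hp0 (fun a => (f a, g a, h a)) a)
    have pD : 0 < D (h a) := h'.trans_le (le_law hp0 h a)
    have := Real.log_le_sub_one_of_pos
      (div_pos (mul_pos pA pB) (mul_pos pT pD))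
    rw [Real.log_div (mul_pos pA pB).ne' (mul_pos pT pD).ne', Real.log_mul pA.ne' pB.ne',
      Real.log_mul pT.ne' pD.ne'] at this
    nlinarith
  refine le_trans ?_ (Finset.sum_le_sum fun a _ => hpt a)
  rw [Finset.sum_sub_distrib, hp.2, sub_nonneg]
  rw [← sum_law_mul p (fun a => (f a, g a, h a))
    fun x => A (x.1, x.2.2) * B (x.2.1, x.2.2) / (T x * D x.2.2)]
  calc ∑ x, T x * (A (x.1, x.2.2) * B (x.2.1, x.2.2) / (T x * D x.2.2))
      ≤ ∑ x : β × γ × δ, A (x.1, x.2.2) * B (x.2.1, x.2.2) / D x.2.2 := by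
        refine Finset.sum_le_sum fun x _ => ?_
        rcases (hT0 x).eq_or_lt with h' | h'
        · rw [← h', zero_mul]; exact div_nonneg (mul_nonneg (hA0 _) (hB0 _)) (hD0 _)
        · rw [← mul_div_assoc, mul_div_mul_left _ _ h'.ne']
    _ = ∑ d, (∑ b, A (b, d)) * (∑ c, B (c, d)) / D d := by
        simp only [Fintype.sum_prod_type, Finset.sum_mul_sum, Finset.sum_div]
        rw [Finset.sum_comm_cycle]
    _ = ∑ d, D d * D d / D d := by
        refine Finset.sum_congr rfl fun d _ => ?_
        rw [sum_law_pair, sum_law_pair]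
    _ ≤ 1 := by
        simp only [mul_self_div_self]
        rw [hD, sum_law, hp.2]

/-- A strictly positive mixture of `condLaw` with the uniform distribution. -/
noncomputable def smoothLaw [Fintype β] (τ : ℝ) (p : α → ℝ) (f : α → β) (g : α → γ) (b : β)
    (d : γ) : ℝ :=
  Real.exp (-τ) * condLaw p f g b d + (1 - Real.exp (-τ)) / Fintype.card β

theorem smoothLaw_pos [Fintype β] [Nonempty β] {τ : ℝ} (hτ : 0 < τ) (hp : ∀ a, 0 ≤ p a)
    (f : α → β) (g : α → γ) (b : β) (d : γ) : 0 < smoothLaw τ p f g b d := by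
  have h1 : Real.exp (-τ) < 1 := Real.exp_lt_one_iff.2 (by linarith)
  have h2 := mul_nonneg (Real.exp_pos (-τ)).le (condLaw_nonneg hp f g b d)
  have h3 : 0 < (1 - Real.exp (-τ)) / Fintype.card β :=
    div_pos (by linarith) (by exact_mod_cast Fintype.card_pos)
  unfold smoothLaw; linarith

theorem sum_smoothLaw [Fintype β] [Nonempty β] (τ : ℝ) (p : α → ℝ) (f : α → β) (g : α → γ)
    (d : γ) : ∑ b, smoothLaw τ p f g b d = 1 := by
  unfold smoothLaw
  rw [Finset.sum_add_distrib, ← Finset.mul_sum, sum_condLaw]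
  have : (Fintype.card β : ℝ) ≠ 0 := by exact_mod_cast Fintype.card_ne_zero
  simp only [Finset.sum_const, Finset.card_univ, nsmul_eq_mul]
  field_simp
  ring

/-- Smoothing makes all logarithms genuine, even at letters of probability zero, which typical
blocks may contain. The mixing weight exp(-τ) limits its entropy cost to `τ`. -/
theorem sum_neg_log_smoothLaw_le [Fintype β] {τ : ℝ} (hτ : 0 < τ)
    (hp : p ∈ stdSimplex ℝ α) (f : α → β) (g : α → γ) :
    ∑ a, p a * -Real.log (smoothLaw τ p f g (f a) (g a)) ≤ condEntropy p f g + τ := by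
  have : condEntropy p f g + τ = ∑ a, p a * (-Real.log (condLaw p f g (f a) (g a)) + τ) := by
    simp only [mul_add, Finset.sum_add_distrib, ← Finset.sum_mul, hp.2, condEntropy, one_mul]
  rw [this]
  refine Finset.sum_le_sum fun a _ => ?_
  rcases (hp.1 a).eq_or_lt with h | h
  · simp [← h]
  refine mul_le_mul_of_nonneg_left ?_ h.le
  have hk := condLaw_pos hp.1 f g h
  have h1 : Real.exp (-τ) * condLaw p f g (f a) (g a) ≤ smoothLaw τ p f g (f a) (g a) := by
    have : 0 ≤ (1 - Real.exp (-τ)) / Fintype.card β :=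
      div_nonneg (by linarith [Real.exp_lt_one_iff.2 (neg_lt_zero.2 hτ)]) (by positivity)
    unfold smoothLaw; linarith
  have h2 := Real.log_le_log (mul_pos (Real.exp_pos _) hk) h1
  rw [Real.log_mul (Real.exp_pos _).ne' hk.ne', Real.log_exp] at h2
  linarith

end Entropy

/-! ### Consequences of the Markov chains: factorisation and the three rate identities. -/

section Admissible

variable {X₁ X₂ X₃ V₁ V₂ U₁ U₂ : Type*} [Fintype X₁] [Fintype X₂] [Fintype X₃] [Fintype V₁]
  [Fintype V₂] [Fintype U₁] [Fintype U₂] {q : Source X₁ X₂ X₃ V₁ V₂ → ℝ}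
  {p : Joint X₁ X₂ X₃ V₁ V₂ U₁ U₂ → ℝ}

/-- The chain rule, with each conditional law shortened by its Markov chain. Hence running the two
test channels on blocks of type `q` reproduces averages under `p`. -/
theorem admissible_factor (hp : p ∈ admissible q) (s : Source X₁ X₂ X₃ V₁ V₂) (u : U₁) (v : U₂) :
    p (s, u, v) = q s * (condLaw p rvU₁ (fun s => (rvX₁ s, rvV₁ s)) u (s.1, s.2.2.2.1) *
      condLaw p rvU₂ (fun s => (rvU₁ s, rvX₂ s, rvV₁ s)) v (u, s.2.1, s.2.2.2.1)) := by
  obtain ⟨hp, hq, hM₁, hM₂⟩ := hp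
  set a : Joint X₁ X₂ X₃ V₁ V₂ U₁ U₂ := (s, u, v) with ha
  have h2 := hM₂.law_eq hp.1 (rvU₂ a) (rvU₁ a, rvX₂ a, rvV₁ a) (rvX₁ a, rvX₃ a, rvV₂ a)
  have h1 := hM₁.law_eq hp.1 (rvU₁ a) (rvX₁ a, rvV₁ a) (rvX₂ a, rvX₃ a, rvV₂ a)
  have e0 := law_apply_of_injective (p := p)
    (f := fun a => (rvU₂ a, (rvU₁ a, rvX₂ a, rvV₁ a), (rvX₁ a, rvX₃ a, rvV₂ a)))
    (by
      rintro ⟨⟨x1, x2, x3, v1, v2⟩, u1, u2⟩ ⟨⟨x1', x2', x3', v1', v2'⟩, u1', u2'⟩ h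
      simp only [rvX₁, rvX₂, rvX₃, rvV₁, rvV₂, rvU₁, rvU₂, Prod.mk.injEq] at h ⊢
      tauto) a
  have e1 := law_congr (p := p)
    (f := fun a => ((rvU₁ a, rvX₂ a, rvV₁ a), (rvX₁ a, rvX₃ a, rvV₂ a)))
    (g := fun a => (rvU₁ a, (rvX₁ a, rvV₁ a), (rvX₂ a, rvX₃ a, rvV₂ a)))
    (by intro a a'; simp only [Prod.mk.injEq]; tauto) a
  have e2 := law_congr (p := p)
    (f := fun a => ((rvX₁ a, rvV₁ a), (rvX₂ a, rvX₃ a, rvV₂ a))) (g := Prod.fst)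
    (by
      rintro ⟨⟨x1, x2, x3, v1, v2⟩, u1, u2⟩ ⟨⟨x1', x2', x3', v1', v2'⟩, u1', u2'⟩
      simp only [rvX₁, rvX₂, rvX₃, rvV₁, rvV₂, Prod.mk.injEq]
      tauto) a
  rw [← e0, h2, e1, h1, e2, hq]
  simp only [ha, rvX₁, rvX₂, rvV₁, rvU₁, rvU₂]
  ring

/-- The Markov chain gives H(U₁|X₁X₂V₁) = H(U₁|X₁V₁). The factor `Real.log 2` converts bits to nats.
-/
theorem condMutualInfo_first (hp : p ∈ admissible q) :
    condMutualInfo p rvX₁ rvU₁ (fun s => (rvX₂ s, rvV₁ s)) * Real.log 2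
      = condEntropy p rvU₁ (fun s => (rvX₂ s, rvV₁ s))
        - condEntropy p rvU₁ (fun s => (rvX₁ s, rvV₁ s)) := by
  obtain ⟨hp, -, hM₁, -⟩ := hp
  have hl : Real.log 2 ≠ 0 := (Real.log_pos (by norm_num)).ne'
  have h1 := condEntropy_eq hp.1 rvU₁ (fun s => (rvX₂ s, rvV₁ s))
  have h2 := (hM₁.comp_right Prod.fst).entropy_add hp.1
  have e1 : entropy p (fun a => (rvU₁ a, (rvX₁ a, rvV₁ a), rvX₂ a))
      = entropy p fun a => (rvX₁ a, rvU₁ a, rvX₂ a, rvV₁ a) :=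
    entropy_congr fun a a' => by simp only [Prod.mk.injEq]; tauto
  have e2 : entropy p (fun a => ((rvX₁ a, rvV₁ a), rvX₂ a))
      = entropy p fun a => (rvX₁ a, rvX₂ a, rvV₁ a) :=
    entropy_congr fun a a' => by simp only [Prod.mk.injEq]; tauto
  simp only at h2
  rw [e1, e2] at h2
  rw [← eq_div_iff hl, sub_div, h1, condMutualInfo]
  linarith

theorem condMutualInfo_second (hp : p ∈ admissible q) :
    condMutualInfo p rvX₂ rvU₂ (fun s => (rvX₃ s, rvV₁ s, rvV₂ s, rvU₁ s)) * Real.log 2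
      = condEntropy p rvU₂ (fun s => (rvX₃ s, rvV₁ s, rvV₂ s, rvU₁ s))
        - condEntropy p rvU₂ (fun s => (rvU₁ s, rvX₂ s, rvV₁ s)) := by
  obtain ⟨hp, -, -, hM₂⟩ := hp
  have hl : Real.log 2 ≠ 0 := (Real.log_pos (by norm_num)).ne'
  have h1 := condEntropy_eq hp.1 rvU₂ (fun s => (rvX₃ s, rvV₁ s, rvV₂ s, rvU₁ s))
  have h2 := (hM₂.comp_right Prod.snd).entropy_add hp.1
  have e1 : entropy p (fun a => (rvU₂ a, (rvU₁ a, rvX₂ a, rvV₁ a), (rvX₃ a, rvV₂ a)))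
      = entropy p fun a => (rvX₂ a, rvU₂ a, rvX₃ a, rvV₁ a, rvV₂ a, rvU₁ a) :=
    entropy_congr fun a a' => by simp only [Prod.mk.injEq]; tauto
  have e2 : entropy p (fun a => ((rvU₁ a, rvX₂ a, rvV₁ a), (rvX₃ a, rvV₂ a)))
      = entropy p fun a => (rvX₂ a, rvX₃ a, rvV₁ a, rvV₂ a, rvU₁ a) :=
    entropy_congr fun a a' => by simp only [Prod.mk.injEq]; tauto
  simp only at h2
  rw [e1, e2] at h2
  rw [← eq_div_iff hl, sub_div, h1, condMutualInfo]
  linarith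

theorem condMutualInfo_sum (hp : p ∈ admissible q) :
    condMutualInfo p (fun s => (rvX₁ s, rvX₂ s)) (fun s => (rvU₁ s, rvU₂ s))
        (fun s => (rvX₃ s, rvV₁ s, rvV₂ s)) * Real.log 2
      = condEntropy p (fun s => (rvU₁ s, rvU₂ s)) (fun s => (rvX₃ s, rvV₁ s, rvV₂ s))
        - condEntropy p rvU₁ (fun s => (rvX₁ s, rvV₁ s))
        - condEntropy p rvU₂ (fun s => (rvU₁ s, rvX₂ s, rvV₁ s)) := by
  obtain ⟨hp, -, hM₁, hM₂⟩ := hp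
  have hl : Real.log 2 ≠ 0 := (Real.log_pos (by norm_num)).ne'
  have h1 := condEntropy_eq hp.1 (fun s => (rvU₁ s, rvU₂ s)) (fun s => (rvX₃ s, rvV₁ s, rvV₂ s))
  have h2 := hM₂.entropy_add hp.1
  have h3 := hM₁.entropy_add hp.1
  have e1 : entropy p (fun a => (rvU₂ a, (rvU₁ a, rvX₂ a, rvV₁ a), (rvX₁ a, rvX₃ a, rvV₂ a)))
      = entropy p fun a => ((rvX₁ a, rvX₂ a), (rvU₁ a, rvU₂ a), (rvX₃ a, rvV₁ a, rvV₂ a)) :=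
    entropy_congr fun a a' => by simp only [Prod.mk.injEq]; tauto
  have e2 : entropy p (fun a => ((rvU₁ a, rvX₂ a, rvV₁ a), (rvX₁ a, rvX₃ a, rvV₂ a)))
      = entropy p fun a => (rvU₁ a, (rvX₁ a, rvV₁ a), (rvX₂ a, rvX₃ a, rvV₂ a)) :=
    entropy_congr fun a a' => by simp only [Prod.mk.injEq]; tauto
  have e3 : entropy p (fun a => ((rvX₁ a, rvV₁ a), (rvX₂ a, rvX₃ a, rvV₂ a)))
      = entropy p fun a => ((rvX₁ a, rvX₂ a), (rvX₃ a, rvV₁ a, rvV₂ a)) :=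
    entropy_congr fun a a' => by simp only [Prod.mk.injEq]; tauto
  rw [e1, e2] at h2
  rw [e3] at h3
  rw [← eq_div_iff hl, sub_div, sub_div, h1, condMutualInfo]
  linarith

end Admissible

/-! ### Memoryless kernels on blocks. -/

section Blocks

variable {β γ : Type*} {n : ℕ}

/-- Probability of the block `u` given the block `d` for the memoryless kernel `k`. -/
noncomputable def blockProd (k : β → γ → ℝ) (d : Fin n → γ) (u : Fin n → β) : ℝ :=
  ∏ t, k (u t) (d t)

theorem blockProd_nonneg {k : β → γ → ℝ} (hk : ∀ b d, 0 ≤ k b d) (d : Fin n → γ) (u : Fin n → β) :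
    0 ≤ blockProd k d u :=
  Finset.prod_nonneg fun _ _ => hk _ _

theorem sum_blockProd [Fintype β] {k : β → γ → ℝ} (hk : ∀ d, ∑ b, k b d = 1) (d : Fin n → γ) :
    ∑ u, blockProd k d u = 1 := by
  unfold blockProd
  rw [sum_prod_apply fun t y => k y (d t)]
  simp [hk]

theorem sum_neg_log_lt_of_lt_blockProd {k : β → γ → ℝ} {d : Fin n → γ}
    {u : Fin n → β} {x : ℝ} (h : Real.exp (-x) < blockProd k d u) :
    ∑ t, -Real.log (k (u t) (d t)) < x := by
  have hpos := (Real.exp_pos _).trans h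
  have hne : ∀ t ∈ Finset.univ, k (u t) (d t) ≠ 0 := Finset.prod_ne_zero_iff.1 hpos.ne'
  rw [Finset.sum_neg_distrib, ← Real.log_prod hne]
  have := (Real.lt_log_iff_exp_lt hpos).2 h
  unfold blockProd at this
  linarith

/-- Strict positivity matters here: a zero factor kills the product, but adds nothing to the sum
since `Real.log 0 = 0`. This is why the lists use smoothed kernels. In the opposite direction a
lower bound on the product already excludes zero factors. -/
theorem lt_sum_neg_log_of_blockProd_lt {k : β → γ → ℝ} (hk : ∀ b d, 0 < k b d) {d : Fin n → γ}
    {u : Fin n → β} {x : ℝ} (h : blockProd k d u < Real.exp (-x)) :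
    x < ∑ t, -Real.log (k (u t) (d t)) := by
  have hpos : 0 < blockProd k d u := Finset.prod_pos fun _ _ => hk _ _
  rw [Finset.sum_neg_distrib, ← Real.log_prod fun t _ => (hk _ _).ne']
  have := (Real.log_lt_iff_lt_exp hpos).2 h
  unfold blockProd at this
  linarith

theorem sum_sum_blocks {U V : Type*} [Fintype U] [Fintype V]
    (F : (Fin n → U) → (Fin n → V) → ℝ) :
    ∑ u, ∑ v, F u v = ∑ w : Fin n → U × V, F (fun t => (w t).1) fun t => (w t).2 := by
  rw [← Fintype.sum_prod_type']
  exact (Fintype.sum_equiv (Equiv.arrowProdEquivProdArrow (Fin n) (fun _ => U) (fun _ => V)) _ _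
    fun w => rfl).symm

end Blocks

/-! ### Decoding lists and typicality of the descriptions. -/

section Coding

variable {X₁ X₂ X₃ V₁ V₂ U₁ U₂ : Type*} [Fintype X₁] [Fintype X₂] [Fintype X₃] [Fintype V₁]
  [Fintype V₂] [Fintype U₁] [Fintype U₂] {q : Source X₁ X₂ X₃ V₁ V₂ → ℝ}

/-- Test channel of the first encoder. -/
noncomputable def channel₁ (p : Joint X₁ X₂ X₃ V₁ V₂ U₁ U₂ → ℝ) : U₁ → X₁ × V₁ → ℝ :=
  condLaw p rvU₁ fun s => (rvX₁ s, rvV₁ s)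

/-- Test channel of the second encoder. -/
noncomputable def channel₂ (p : Joint X₁ X₂ X₃ V₁ V₂ U₁ U₂ → ℝ) : U₂ → U₁ × X₂ × V₁ → ℝ :=
  condLaw p rvU₂ fun s => (rvU₁ s, rvX₂ s, rvV₁ s)

open Classical in
/-- First descriptions that are likely given the side information of the second encoder. -/
noncomputable def list₁ (p : Joint X₁ X₂ X₃ V₁ V₂ U₁ U₂ → ℝ) (γ : ℝ) {n : ℕ}
    (a : Fin n → X₂ × V₁) : Finset (Fin n → U₁) :=
  Finset.univ.filter fun u =>
    Real.exp (-(n * (condEntropy p rvU₁ (fun s => (rvX₂ s, rvV₁ s)) + 2 * γ)))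
      ≤ blockProd (smoothLaw γ p rvU₁ fun s => (rvX₂ s, rvV₁ s)) a u

open Classical in
/-- Pairs of descriptions that are likely given the side information of the decoder. -/
noncomputable def list (p : Joint X₁ X₂ X₃ V₁ V₂ U₁ U₂ → ℝ) (γ : ℝ) {n : ℕ}
    (a : Fin n → X₃ × V₁ × V₂) : Finset ((Fin n → U₁) × (Fin n → U₂)) :=
  Finset.univ.filter fun x =>
    Real.exp (-(n * (condEntropy p rvU₂ (fun s => (rvX₃ s, rvV₁ s, rvV₂ s, rvU₁ s)) + 2 * γ)))
      ≤ blockProd (smoothLaw γ p rvU₂ fun s => (rvX₃ s, rvV₁ s, rvV₂ s, rvU₁ s))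
          (fun t => ((a t).1, (a t).2.1, (a t).2.2, x.1 t)) x.2 ∧
    Real.exp (-(n * (condEntropy p (fun s => (rvU₁ s, rvU₂ s))
        (fun s => (rvX₃ s, rvV₁ s, rvV₂ s)) + 2 * γ)))
      ≤ blockProd (smoothLaw γ p (fun s => (rvU₁ s, rvU₂ s)) fun s => (rvX₃ s, rvV₁ s, rvV₂ s))
          a fun t => (x.1 t, x.2 t)

variable {p : Joint X₁ X₂ X₃ V₁ V₂ U₁ U₂ → ℝ}

theorem nonempty_of_mem_stdSimplex {α : Type*} [Fintype α] {p : α → ℝ} (hp : p ∈ stdSimplex ℝ α) :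
    Nonempty α := by
  by_contra h
  rw [not_nonempty_iff] at h
  simpa using hp.2

theorem card_list₁_le [Nonempty U₁] (hp : p ∈ admissible q) {γ : ℝ} (hγ : 0 < γ) {n : ℕ}
    (a : Fin n → X₂ × V₁) :
    ((list₁ p γ a).card : ℝ)
      ≤ Real.exp (n * (condEntropy p rvU₁ (fun s => (rvX₂ s, rvV₁ s)) + 2 * γ)) :=
  card_filter_exp_le
    (fun u => blockProd_nonneg (fun b d => (smoothLaw_pos hγ hp.1.1 _ _ b d).le) a u)
    (sum_blockProd (sum_smoothLaw γ p _ _) a).le _ _ fun _ hu => (Finset.mem_filter.1 hu).2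

theorem card_list_le [Nonempty U₁] [Nonempty U₂] (hp : p ∈ admissible q) {γ : ℝ} (hγ : 0 < γ)
    {n : ℕ} (a : Fin n → X₃ × V₁ × V₂) :
    ((list p γ a).card : ℝ)
      ≤ Real.exp (n * (condEntropy p (fun s => (rvU₁ s, rvU₂ s))
        (fun s => (rvX₃ s, rvV₁ s, rvV₂ s)) + 2 * γ)) := by
  refine card_filter_exp_le (P := fun x : (Fin n → U₁) × (Fin n → U₂) =>
      blockProd (smoothLaw γ p (fun s => (rvU₁ s, rvU₂ s)) fun s => (rvX₃ s, rvV₁ s, rvV₂ s))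
          a fun t => (x.1 t, x.2 t))
    (fun u => blockProd_nonneg (fun b d => (smoothLaw_pos hγ hp.1.1 _ _ b d).le) a _) ?_ _ _
    fun _ hu => (Finset.mem_filter.1 hu).2.2
  rw [Fintype.sum_prod_type, sum_sum_blocks]
  exact (sum_blockProd (sum_smoothLaw γ p _ _) a).le

/-- This is the purpose of the first condition in `list`: it controls the candidates for the second
block once the first is known. The second condition controls the pairs. -/
theorem card_list_section_le [Nonempty U₂] [DecidableEq U₁] (hp : p ∈ admissible q)
    {γ : ℝ} (hγ : 0 < γ) {n : ℕ} (a : Fin n → X₃ × V₁ × V₂) (u : Fin n → U₁) :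
    (((list p γ a).filter fun x => x.1 = u).card : ℝ)
      ≤ Real.exp (n * (condEntropy p rvU₂ (fun s => (rvX₃ s, rvV₁ s, rvV₂ s, rvU₁ s))
        + 2 * γ)) := by
  have hs : ∀ v, 0 ≤ blockProd (smoothLaw γ p rvU₂ fun s => (rvX₃ s, rvV₁ s, rvV₂ s, rvU₁ s))
          (fun t => ((a t).1, (a t).2.1, (a t).2.2, u t)) v := fun v =>
    blockProd_nonneg (fun b d => (smoothLaw_pos hγ hp.1.1 _ _ b d).le) _ v
  refine card_filter_exp_le (P := fun x : (Fin n → U₁) × (Fin n → U₂) => if x.1 = u then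
      blockProd (smoothLaw γ p rvU₂ fun s => (rvX₃ s, rvV₁ s, rvV₂ s, rvU₁ s))
          (fun t => ((a t).1, (a t).2.1, (a t).2.2, u t)) x.2 else 0)
    (fun x => by split_ifs; exacts [hs _, le_rfl]) ?_ _ _
    fun x hx => ?_
  · rw [Fintype.sum_prod_type_right]
    simp only [Finset.sum_ite_eq', Finset.mem_univ, if_true]
    exact (sum_blockProd (sum_smoothLaw γ p _ _) _).le
  · obtain ⟨hxl, rfl⟩ := Finset.mem_filter.1 hx
    rw [if_pos rfl]
    exact (Finset.mem_filter.1 hxl).2.1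

/-- Under the test channels, blocks of descriptions behave typically given a typical source
block. -/
theorem exists_typical_descriptions (hq : q ∈ stdSimplex ℝ (Source X₁ X₂ X₃ V₁ V₂))
    (hp : p ∈ admissible q) [Nonempty U₁] [Nonempty U₂] {γ ε : ℝ} (hγ : 0 < γ)
    (hγε : γ ≤ ε / Fintype.card (Joint X₁ X₂ X₃ V₁ V₂ U₁ U₂)) :
    ∃ δ : ℝ, 0 < δ ∧ ∃ n₀ : ℕ, ∀ n, n₀ < n → ∀ s ∈ typicalSet q δ n,
      (∑ u, blockProd (channel₁ p) (fun t => ((s t).1, (s t).2.2.2.1)) u *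
        ind (Real.exp (-(n * (condEntropy p rvU₁ (fun s => (rvX₁ s, rvV₁ s)) - γ)))
          < blockProd (channel₁ p) (fun t => ((s t).1, (s t).2.2.2.1)) u) ≤ γ) ∧
      (∑ u : Fin n → U₁, ∑ v, blockProd (channel₁ p) (fun t => ((s t).1, (s t).2.2.2.1)) u *
          blockProd (channel₂ p) (fun t => (u t, (s t).2.1, (s t).2.2.2.1)) v *
        ind (Real.exp (-(n * (condEntropy p rvU₂ (fun s => (rvU₁ s, rvX₂ s, rvV₁ s)) - γ)))
          < blockProd (channel₂ p) (fun t => (u t, (s t).2.1, (s t).2.2.2.1)) v) ≤ γ) ∧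
      (∑ u : Fin n → U₁, ∑ v, blockProd (channel₁ p) (fun t => ((s t).1, (s t).2.2.2.1)) u *
          blockProd (channel₂ p) (fun t => (u t, (s t).2.1, (s t).2.2.2.1)) v *
        ind (¬((fun t => (s t, u t, v t)) ∈ typicalSet p ε n ∧
          u ∈ list₁ p γ (fun t => ((s t).2.1, (s t).2.2.2.1)) ∧
          (u, v) ∈ list p γ (fun t => ((s t).2.2.1, (s t).2.2.2.1, (s t).2.2.2.2))))
        ≤ (Fintype.card (Joint X₁ X₂ X₃ V₁ V₂ U₁ U₂) + 3) * γ) := by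
  have hp0 := hp.1.1
  let κ : Source X₁ X₂ X₃ V₁ V₂ → U₁ × U₂ → ℝ := fun s y =>
    channel₁ p y.1 (s.1, s.2.2.2.1) * channel₂ p y.2 (y.1, s.2.1, s.2.2.2.1)
  have k1 : ∀ b d, 0 ≤ channel₁ p b d := fun b d => condLaw_nonneg hp0 _ _ b d
  have k2 : ∀ b d, 0 ≤ channel₂ p b d := fun b d => condLaw_nonneg hp0 _ _ b d
  have k1s : ∀ d, ∑ b, channel₁ p b d = 1 := sum_condLaw p _ _
  have k2s : ∀ d, ∑ b, channel₂ p b d = 1 := sum_condLaw p _ _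
  have hκ0 : ∀ s y, 0 ≤ κ s y := fun s y => mul_nonneg (k1 _ _) (k2 _ _)
  have hκ1 : ∀ s, ∑ y, κ s y = 1 := fun s => by
    simp only [κ, Fintype.sum_prod_type, ← Finset.mul_sum, k2s, mul_one, k1s]
  have hexp : ∀ φ : Joint X₁ X₂ X₃ V₁ V₂ U₁ U₂ → ℝ,
      ∑ s, q s * ∑ y, κ s y * φ (s, y) = ∑ a, p a * φ a := by
    intro φ
    refine Eq.trans ?_ (Fintype.sum_prod_type _).symm
    refine Finset.sum_congr rfl fun s _ => ?_
    rw [Finset.mul_sum]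
    refine Finset.sum_congr rfl fun y _ => ?_
    rw [admissible_factor hp s y.1 y.2]
    simp only [κ, channel₁, channel₂]; ring
  let φ₁ : Joint X₁ X₂ X₃ V₁ V₂ U₁ U₂ → ℝ := fun a =>
    -Real.log (channel₁ p (rvU₁ a) (rvX₁ a, rvV₁ a))
  let φ₂ : Joint X₁ X₂ X₃ V₁ V₂ U₁ U₂ → ℝ := fun a =>
    -Real.log (channel₂ p (rvU₂ a) (rvU₁ a, rvX₂ a, rvV₁ a))
  let φ₃ : Joint X₁ X₂ X₃ V₁ V₂ U₁ U₂ → ℝ := fun a =>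
    -Real.log (smoothLaw γ p rvU₁ (fun s => (rvX₂ s, rvV₁ s)) (rvU₁ a) (rvX₂ a, rvV₁ a))
  let φ₄ : Joint X₁ X₂ X₃ V₁ V₂ U₁ U₂ → ℝ := fun a =>
    -Real.log (smoothLaw γ p rvU₂ (fun s => (rvX₃ s, rvV₁ s, rvV₂ s, rvU₁ s)) (rvU₂ a)
      (rvX₃ a, rvV₁ a, rvV₂ a, rvU₁ a))
  let φ₅ : Joint X₁ X₂ X₃ V₁ V₂ U₁ U₂ → ℝ := fun a =>
    -Real.log (smoothLaw γ p (fun s => (rvU₁ s, rvU₂ s)) (fun s => (rvX₃ s, rvV₁ s, rvV₂ s))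
      (rvU₁ a, rvU₂ a) (rvX₃ a, rvV₁ a, rvV₂ a))
  have hB : ∀ φ : Joint X₁ X₂ X₃ V₁ V₂ U₁ U₂ → ℝ, ∃ C, ∀ a, |φ a| ≤ C := fun φ =>
    ⟨∑ a, |φ a|, fun a => Finset.single_le_sum (f := fun a => |φ a|)
      (fun a _ => abs_nonneg _) (Finset.mem_univ a)⟩
  obtain ⟨C₁, hC₁⟩ := hB φ₁
  obtain ⟨C₂, hC₂⟩ := hB φ₂
  obtain ⟨C₃, hC₃⟩ := hB φ₃
  obtain ⟨C₄, hC₄⟩ := hB φ₄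
  obtain ⟨C₅, hC₅⟩ := hB φ₅
  -- One bound for all test functions; the summand 1 covers the letter indicators used for joint
  -- typicality.
  obtain ⟨C, hC⟩ : ∃ C, C = 1 + |C₁| + |C₂| + |C₃| + |C₄| + |C₅| := ⟨_, rfl⟩
  have hCs := And.intro (abs_nonneg C₁) (And.intro (abs_nonneg C₂) (And.intro (abs_nonneg C₃)
    (And.intro (abs_nonneg C₄) (abs_nonneg C₅))))
  have hCs' := And.intro (le_abs_self C₁) (And.intro (le_abs_self C₂) (And.intro (le_abs_self C₃)
    (And.intro (le_abs_self C₄) (le_abs_self C₅))))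
  obtain ⟨δ, hδ, n₀, hlln⟩ := conditional_lln hq hκ0 hκ1 (C := C) (by linarith) hγ
  refine ⟨δ, hδ, n₀, fun n hn s hs => ?_⟩
  have hn0 : (0 : ℝ) < n := by exact_mod_cast (Nat.zero_le _).trans_lt hn
  let dev : (Joint X₁ X₂ X₃ V₁ V₂ U₁ U₂ → ℝ) → (Fin n → U₁ × U₂) → Prop := fun φ w =>
    γ < |(∑ t, φ (s t, w t)) / n - ∑ a, p a * φ a|
  have hdev : ∀ φ : Joint X₁ X₂ X₃ V₁ V₂ U₁ U₂ → ℝ, (∀ a, |φ a| ≤ C) →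
      ∑ w : Fin n → U₁ × U₂, (∏ t, κ (s t) (w t)) * ind (dev φ w) ≤ γ := by
    intro φ hφ
    have := hlln n hn s hs (fun s y => φ (s, y)) fun s y => hφ (s, y)
    rwa [hexp φ] at this
  have hprod : ∀ w : Fin n → U₁ × U₂,
      blockProd (channel₁ p) (fun t => ((s t).1, (s t).2.2.2.1)) (fun t => (w t).1) *
      blockProd (channel₂ p) (fun t => ((w t).1, (s t).2.1, (s t).2.2.2.1)) (fun t => (w t).2)
      = ∏ t, κ (s t) (w t) := fun w => by
    simp only [blockProd, κ, Finset.prod_mul_distrib]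
  have hκn : ∀ w : Fin n → U₁ × U₂, 0 ≤ ∏ t, κ (s t) (w t) := fun w =>
    Finset.prod_nonneg fun t _ => hκ0 _ _
  have hlow : ∀ (φ : Joint X₁ X₂ X₃ V₁ V₂ U₁ U₂ → ℝ) (w : Fin n → U₁ × U₂) (e : ℝ),
      ∑ a, p a * φ a = e →
      ∑ t, φ (s t, w t) < n * (e - γ) → dev φ w := by
    intro φ w e he h
    have : (∑ t, φ (s t, w t)) / n < e - γ := by rw [div_lt_iff₀ hn0]; linarith
    refine lt_of_lt_of_le ?_ (neg_le_abs _)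
    rw [he]; linarith
  have hhigh : ∀ (φ : Joint X₁ X₂ X₃ V₁ V₂ U₁ U₂ → ℝ) (w : Fin n → U₁ × U₂) (e : ℝ),
      ∑ a, p a * φ a ≤ e + γ →
      n * (e + 2 * γ) < ∑ t, φ (s t, w t) → dev φ w := by
    intro φ w e he h
    have : e + 2 * γ < (∑ t, φ (s t, w t)) / n := by rw [lt_div_iff₀ hn0]; linarith
    refine lt_of_lt_of_le ?_ (le_abs_self _)
    linarith
  refine ⟨?_, ?_, ?_⟩
  -- The second channel sums to 1, so it can be inserted to bring the sum over `u` alone to the pair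
  -- form.
  · have e : ∀ F : (Fin n → U₁) → ℝ,
        ∑ u, blockProd (channel₁ p) (fun t => ((s t).1, (s t).2.2.2.1)) u * F u
        = ∑ u : Fin n → U₁, ∑ v, blockProd (channel₁ p) (fun t => ((s t).1, (s t).2.2.2.1)) u *
          blockProd (channel₂ p) (fun t => (u t, (s t).2.1, (s t).2.2.2.1)) v * F u := by
      intro F
      simp only [← Finset.sum_mul, ← Finset.mul_sum, sum_blockProd k2s, mul_one]
    rw [e, sum_sum_blocks]
    refine le_trans (Finset.sum_le_sum fun w _ => ?_) (hdev φ₁ fun a => (hC₁ a).trans (by linarith))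
    rw [hprod]
    exact mul_le_mul_of_nonneg_left (ind_le_ind fun h => hlow φ₁ w _ rfl
      (sum_neg_log_lt_of_lt_blockProd h)) (hκn w)
  · rw [sum_sum_blocks]
    refine le_trans (Finset.sum_le_sum fun w _ => ?_) (hdev φ₂ fun a => (hC₂ a).trans (by linarith))
    rw [hprod]
    exact mul_le_mul_of_nonneg_left (ind_le_ind fun h => hlow φ₂ w _ rfl
      (sum_neg_log_lt_of_lt_blockProd h)) (hκn w)
  · rw [sum_sum_blocks]
    -- Every failure forces the empirical mean of some test function to deviate: one indicator per
    -- joint letter for typicality, and three log-likelihoods for the lists. This gives the constant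
    -- card + 3.
    have hpt : ∀ w : Fin n → U₁ × U₂,
        ind (¬((fun t => (s t, (w t).1, (w t).2)) ∈ typicalSet p ε n ∧
          (fun t => (w t).1) ∈ list₁ p γ (fun t => ((s t).2.1, (s t).2.2.2.1)) ∧
          ((fun t => (w t).1), (fun t => (w t).2)) ∈
            list p γ (fun t => ((s t).2.2.1, (s t).2.2.2.1, (s t).2.2.2.2))))
        ≤ ∑ a : Joint X₁ X₂ X₃ V₁ V₂ U₁ U₂, ind (dev (fun a' => ind (a' = a)) w)
          + ind (dev φ₃ w) + ind (dev φ₄ w) + ind (dev φ₅ w) := by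
      intro w
      have n1 : ∀ a ∈ Finset.univ, 0 ≤ ind (dev (fun a' => ind (a' = a)) w) :=
        fun _ _ => ind_nonneg _
      have n2 := Finset.sum_nonneg n1
      have n3 := ind_nonneg (dev φ₃ w)
      have n4 := ind_nonneg (dev φ₄ w)
      have n5 := ind_nonneg (dev φ₅ w)
      by_cases h : (fun t => (s t, (w t).1, (w t).2)) ∈ typicalSet p ε n ∧
          (fun t => (w t).1) ∈ list₁ p γ (fun t => ((s t).2.1, (s t).2.2.2.1)) ∧
          ((fun t => (w t).1), (fun t => (w t).2)) ∈
            list p γ (fun t => ((s t).2.2.1, (s t).2.2.2.1, (s t).2.2.2.2))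
      · rw [ind_false (not_not.2 h)]; linarith
      rw [ind_true h]
      by_cases hT : (fun t => (s t, (w t).1, (w t).2)) ∈ typicalSet p ε n
      swap
      · obtain ⟨a, ha⟩ : ∃ a, ¬(p a ≠ 0 →
            |(occurrences (fun t => (s t, (w t).1, (w t).2)) a : ℝ) / n - p a|
              ≤ ε / Fintype.card (Joint X₁ X₂ X₃ V₁ V₂ U₁ U₂)) := not_forall.1 hT
        have ha := not_le.1 (Classical.not_imp.1 ha).2
        have hda : dev (fun a' => ind (a' = a)) w := by
          have e1 : ∑ t, ind ((s t, w t) = a)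
              = occurrences (fun t => (s t, (w t).1, (w t).2)) a := by
            rw [sum_apply_eq_occurrences 
              (fun t => ((s t, (w t).1, (w t).2) : Joint X₁ X₂ X₃ V₁ V₂ U₁ U₂))
              fun a' => ind (a' = a), Finset.sum_eq_single_of_mem a (Finset.mem_univ a)
              (fun b _ hb => by rw [ind_false hb, mul_zero]), ind_true rfl, mul_one]
          have e2 : ∑ a', p a' * ind (a' = a) = p a := by
            rw [Finset.sum_eq_single_of_mem a (Finset.mem_univ a)
              (fun b _ hb => by rw [ind_false hb, mul_zero]), ind_true rfl, mul_one]
          change γ < |(∑ t, ind ((s t, w t) = a)) / n - ∑ a', p a' * ind (a' = a)|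
          rw [e1, e2]
          exact hγε.trans_lt ha
        have := Finset.single_le_sum n1 (Finset.mem_univ a)
        rw [ind_true hda] at this
        linarith
      by_cases h1 : (fun t => (w t).1) ∈ list₁ p γ (fun t => ((s t).2.1, (s t).2.2.2.1))
      swap
      · have : dev φ₃ w := by
          simp only [list₁, Finset.mem_filter, Finset.mem_univ, true_and, not_le] at h1
          exact hhigh φ₃ w _ (sum_neg_log_smoothLaw_le hγ hp.1 _ _)
            (lt_sum_neg_log_of_blockProd_lt (smoothLaw_pos hγ hp0 _ _) h1)
        rw [ind_true this]; linarith
      have h2 : ¬((fun t => (w t).1), (fun t => (w t).2)) ∈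
            list p γ (fun t => ((s t).2.2.1, (s t).2.2.2.1, (s t).2.2.2.2)) :=
        fun h2 => h ⟨hT, h1, h2⟩
      simp only [list, Finset.mem_filter, Finset.mem_univ, true_and, not_and_or, not_le] at h2
      rcases h2 with h2 | h2
      · have : dev φ₄ w := hhigh φ₄ w _ (sum_neg_log_smoothLaw_le hγ hp.1 _ _)
            (lt_sum_neg_log_of_blockProd_lt (smoothLaw_pos hγ hp0 _ _) h2)
        rw [ind_true this]; linarith
      · have : dev φ₅ w := hhigh φ₅ w _ (sum_neg_log_smoothLaw_le hγ hp.1 _ _)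
            (lt_sum_neg_log_of_blockProd_lt (smoothLaw_pos hγ hp0 _ _) h2)
        rw [ind_true this]; linarith
    refine le_trans (Finset.sum_le_sum fun w _ => ?_) (?_ : ∑ w : Fin n → U₁ × U₂,
      (∏ t, κ (s t) (w t)) * (∑ a : Joint X₁ X₂ X₃ V₁ V₂ U₁ U₂,
        ind (dev (fun a' => ind (a' = a)) w) + ind (dev φ₃ w) + ind (dev φ₄ w)
          + ind (dev φ₅ w)) ≤ _)
    · rw [hprod]
      exact mul_le_mul_of_nonneg_left (hpt w) (hκn w)
    · simp only [mul_add, Finset.sum_add_distrib, Finset.mul_sum]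
      rw [Finset.sum_comm]
      have h0 : ∑ a : Joint X₁ X₂ X₃ V₁ V₂ U₁ U₂, ∑ w : Fin n → U₁ × U₂,
          (∏ t, κ (s t) (w t)) * ind (dev (fun a' => ind (a' = a)) w)
            ≤ ∑ _a : Joint X₁ X₂ X₃ V₁ V₂ U₁ U₂, γ :=
        Finset.sum_le_sum fun a _ => hdev (fun a' => ind (a' = a)) fun a' => by
          rw [abs_of_nonneg (ind_nonneg _)]
          exact (ind_le_one _).trans (by linarith)
      have h3 := hdev φ₃ fun a => (hC₃ a).trans (by linarith)
      have h4 := hdev φ₄ fun a => (hC₄ a).trans (by linarith)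
      have h5 := hdev φ₅ fun a => (hC₅ a).trans (by linarith)
      rw [Finset.sum_const, nsmul_eq_mul, Finset.card_univ] at h0
      linarith

end Coding

/-! ### Choice of the parameters and conclusion for long blocks. -/

section Achievability

variable {X₁ X₂ X₃ V₁ V₂ U₁ U₂ : Type*} [Fintype X₁] [Fintype X₂] [Fintype X₃] [Fintype V₁]
  [Fintype V₂] [Fintype U₁] [Fintype U₂] {q : Source X₁ X₂ X₃ V₁ V₂ → ℝ}
  {p : Joint X₁ X₂ X₃ V₁ V₂ U₁ U₂ → ℝ}

theorem logb_floor_exp_add_one_le {r ε : ℝ} (hr : 0 ≤ r) {n : ℕ} (hn : 0 < n) (hnε : 1 / ε ≤ n)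
    (hε : 0 < ε) :
    Real.logb 2 ((⌊Real.exp (n * (r * Real.log 2))⌋₊ + 1 : ℕ) : ℝ) / n ≤ r + ε := by
  have hn' : (0 : ℝ) < n := by exact_mod_cast hn
  have hl : 0 < Real.log 2 := Real.log_pos (by norm_num)
  have h1 : ((⌊Real.exp (n * (r * Real.log 2))⌋₊ + 1 : ℕ) : ℝ)
      ≤ 2 * Real.exp (n * (r * Real.log 2)) := by
    have h2 := Nat.floor_le (Real.exp_pos (n * (r * Real.log 2))).le
    have h3 : 1 ≤ Real.exp (n * (r * Real.log 2)) := Real.one_le_exp (by positivity)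
    push_cast; linarith
  rw [div_le_iff₀ hn', Real.logb, div_le_iff₀ hl]
  refine (Real.log_le_log (by positivity) h1).trans ?_
  rw [Real.log_mul (by norm_num) (Real.exp_pos _).ne', Real.log_exp]
  rw [div_le_iff₀ hε] at hnε
  nlinarith

theorem exp_div_mul_le {x f m y : ℝ} {F M : ℕ} (hF : Real.exp f ≤ F) (hM : Real.exp m ≤ M)
    (h : x - f - m ≤ y) : Real.exp x / (F * M) ≤ Real.exp y := by
  have hF0 := (Real.exp_pos f).trans_le hF
  have hM0 := (Real.exp_pos m).trans_le hM
  rw [div_le_iff₀ (mul_pos hF0 hM0)]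
  calc Real.exp x ≤ Real.exp (y + (f + m)) := Real.exp_le_exp.2 (by linarith)
    _ = Real.exp y * (Real.exp f * Real.exp m) := by rw [Real.exp_add, Real.exp_add]
    _ ≤ Real.exp y * (F * M) := mul_le_mul_of_nonneg_left
        (mul_le_mul hF hM (Real.exp_pos _).le hF0.le) (Real.exp_pos _).le

theorem rateRegion_subset_achievableRates
    (hq : q ∈ stdSimplex ℝ (Source X₁ X₂ X₃ V₁ V₂))
    {Q : (n : ℕ) → (Fin n → Source X₁ X₂ X₃ V₁ V₂) → ℝ}
    (hQ : ∀ n, Q n ∈ stdSimplex ℝ (Fin n → Source X₁ X₂ X₃ V₁ V₂))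
    (hQq : AsymptoticallyTypical q Q) (hp : p ∈ admissible q) :
    rateRegion p ⊆ achievableRates Q p := by
  classical
  rintro ⟨R₁, R₂⟩ ⟨hR₁, hR₂, hR⟩ ε hε
  dsimp only at hR₁ hR₂ hR ⊢
  obtain ⟨⟨_, u₀, v₀⟩⟩ := nonempty_of_mem_stdSimplex hp.1
  have : Nonempty U₁ := ⟨u₀⟩
  have : Nonempty U₂ := ⟨v₀⟩
  have hl : 0 < Real.log 2 := Real.log_pos (by norm_num)
  have hR₁0 : 0 ≤ R₁ := (condMutualInfo_nonneg hp.1 _ _ _).trans hR₁.le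
  have hR₂0 : 0 ≤ R₂ := (condMutualInfo_nonneg hp.1 _ _ _).trans hR₂.le
  have hr₁ := mul_lt_mul_of_pos_right hR₁ hl
  have hr₂ := mul_lt_mul_of_pos_right hR₂ hl
  have hr := mul_lt_mul_of_pos_right hR hl
  rw [condMutualInfo_first hp] at hr₁
  rw [condMutualInfo_second hp] at hr₂
  rw [condMutualInfo_sum hp, add_mul] at hr
  set h₁ := condEntropy p rvU₁ (fun s => (rvX₁ s, rvV₁ s)) with hh₁
  set h₂ := condEntropy p rvU₂ (fun s => (rvU₁ s, rvX₂ s, rvV₁ s)) with hh₂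
  set k₁ := condEntropy p rvU₁ (fun s => (rvX₂ s, rvV₁ s)) with hk₁
  set k₂ := condEntropy p rvU₂ (fun s => (rvX₃ s, rvV₁ s, rvV₂ s, rvU₁ s)) with hk₂
  set k := condEntropy p (fun s => (rvU₁ s, rvU₂ s)) (fun s => (rvX₃ s, rvV₁ s, rvV₂ s)) with hk
  set r₁ := R₁ * Real.log 2 with hr₁def
  set r₂ := R₂ * Real.log 2 with hr₂def
  set N : ℝ := (Fintype.card (Joint X₁ X₂ X₃ V₁ V₂ U₁ U₂) : ℝ) with hN
  have hN0 : 0 < N := by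
    have := nonempty_of_mem_stdSimplex hp.1
    exact Nat.cast_pos.2 Fintype.card_pos
  -- The 7 comes from the sum rate: 2γ for the list, 2γ for each frozen bin, and a final γ of decay;
  -- the other gaps need only 5γ. The total error is 20γ + 40γ + 4((N+3)γ + 3γ) = (84 + 4N)γ, to be
  -- at most ε/2.
  obtain ⟨γ, hγ, hγ₁, hγ₂, hγ₃, hγ₄, hγ₅⟩ : ∃ γ : ℝ, 0 < γ ∧ γ ≤ (r₁ - (k₁ - h₁)) / 7 ∧
      γ ≤ (r₂ - (k₂ - h₂)) / 7 ∧ γ ≤ (r₁ + r₂ - (k - h₁ - h₂)) / 7 ∧ γ ≤ ε / N ∧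
      γ ≤ ε / 2 / (84 + 4 * N) := by
    refine ⟨min ((r₁ - (k₁ - h₁)) / 7) (min ((r₂ - (k₂ - h₂)) / 7)
      (min ((r₁ + r₂ - (k - h₁ - h₂)) / 7) (min (ε / N) (ε / 2 / (84 + 4 * N))))), ?_, ?_⟩
    · refine lt_min (by linarith) (lt_min (by linarith) (lt_min (by linarith)
        (lt_min (by positivity) (by positivity))))
    · simp
  obtain ⟨δ, hδ, n₁, hn₁⟩ := exists_typical_descriptions hq hp hγ hγ₄
  have hlim := (hQq δ hδ).eventually (lt_mem_nhds (show 1 - ε / 2 < 1 by linarith))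
  obtain ⟨n₂, hn₂⟩ := eventually_atTop.1 hlim
  refine ⟨max (max n₁ n₂) (max ⌈1 / ε⌉₊ ⌈1 / γ ^ 2⌉₊), fun n hn => ?_⟩
  obtain ⟨⟨hnn₁, hnn₂⟩, hnε, hnγ⟩ : (n₁ < n ∧ n₂ < n) ∧ ⌈1 / ε⌉₊ < n ∧ ⌈1 / γ ^ 2⌉₊ < n := by
    simpa only [max_lt_iff] using hn
  have hn0 : 0 < n := (Nat.zero_le _).trans_lt hnn₁
  have hn0' : (0 : ℝ) < n := by exact_mod_cast hn0
  have hnε' : 1 / ε ≤ n := (Nat.le_ceil _).trans (by exact_mod_cast hnε.le)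
  have hnγ' : 1 / γ ^ 2 ≤ n := (Nat.le_ceil _).trans (by exact_mod_cast hnγ.le)
  have hsmall : Real.exp (-(n * γ)) ≤ γ := by
    rw [Real.exp_neg, inv_le_comm₀ (Real.exp_pos _) hγ]
    rw [div_le_iff₀ (by positivity)] at hnγ'
    have h1 : γ⁻¹ ≤ n * γ := by
      rw [inv_le_iff_one_le_mul₀ hγ]; linarith [sq γ]
    linarith [Real.add_one_le_exp (n * γ)]
  -- Adding 1 to the floor bounds the size below by the exponential, for collisions, while F - 1
  -- stays below it, for the variance. If the exponent is negative, F = 1 and nothing is frozen.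
  let F₁ : ℕ := ⌊Real.exp (n * (h₁ - 2 * γ))⌋₊ + 1
  let F₂ : ℕ := ⌊Real.exp (n * (h₂ - 2 * γ))⌋₊ + 1
  let M₁ : ℕ := ⌊Real.exp (n * r₁)⌋₊ + 1
  let M₂ : ℕ := ⌊Real.exp (n * r₂)⌋₊ + 1
  have hF₁ : Real.exp (n * (h₁ - 2 * γ)) ≤ F₁ := by
    simp only [F₁]; push_cast; exact (Nat.lt_floor_add_one _).le
  have hF₂ : Real.exp (n * (h₂ - 2 * γ)) ≤ F₂ := by
    simp only [F₂]; push_cast; exact (Nat.lt_floor_add_one _).le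
  have hM₁ : Real.exp (n * r₁) ≤ M₁ := by
    simp only [M₁]; push_cast; exact (Nat.lt_floor_add_one _).le
  have hM₂ : Real.exp (n * r₂) ≤ M₂ := by
    simp only [M₂]; push_cast; exact (Nat.lt_floor_add_one _).le
  have hcov : ∀ h : ℝ, (((⌊Real.exp (n * (h - 2 * γ))⌋₊ + 1 : ℕ) : ℝ) - 1)
      * Real.exp (-(n * (h - γ))) ≤ γ := by
    intro h
    refine le_trans ?_ hsmall
    calc _ ≤ Real.exp (n * (h - 2 * γ)) * Real.exp (-(n * (h - γ))) := by
          refine mul_le_mul_of_nonneg_right ?_ (Real.exp_pos _).le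
          push_cast
          rw [add_sub_cancel_right]
          exact Nat.floor_le (Real.exp_pos _).le
      _ = Real.exp (-(n * γ)) := by rw [← Real.exp_add]; congr 1; ring
  have s₁ : 0 ≤ n * (r₁ - (k₁ - h₁) - 7 * γ) := mul_nonneg hn0'.le (by linarith)
  have s₂ : 0 ≤ n * (r₂ - (k₂ - h₂) - 7 * γ) := mul_nonneg hn0'.le (by linarith)
  have s₃ : 0 ≤ n * (r₁ + r₂ - (k - h₁ - h₂) - 7 * γ) := mul_nonneg hn0'.le (by linarith)
  have s₀ : 0 ≤ n * γ := by positivity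
  have hK₁ : Real.exp (n * (k₁ + 2 * γ)) / (F₁ * M₁) ≤ γ :=
    (exp_div_mul_le hF₁ hM₁ (by linarith)).trans hsmall
  have hK₂ : Real.exp (n * (k₂ + 2 * γ)) / (F₂ * M₂) ≤ γ :=
    (exp_div_mul_le hF₂ hM₂ (by linarith)).trans hsmall
  have hK : Real.exp (n * (k + 2 * γ)) / (F₁ * M₁ * (F₂ * M₂)) ≤ γ := by
    have e₁ : Real.exp (n * (h₁ - 2 * γ) + n * r₁) ≤ ((F₁ * M₁ : ℕ) : ℝ) := by
      rw [Real.exp_add]; push_cast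
      exact mul_le_mul hF₁ hM₁ (Real.exp_pos _).le (by positivity)
    have e₂ : Real.exp (n * (h₂ - 2 * γ) + n * r₂) ≤ ((F₂ * M₂ : ℕ) : ℝ) := by
      rw [Real.exp_add]; push_cast
      exact mul_le_mul hF₂ hM₂ (Real.exp_pos _).le (by positivity)
    have := (exp_div_mul_le e₁ e₂ (x := n * (k + 2 * γ)) (y := -(n * γ)) (by linarith)).trans
      hsmall
    push_cast at this
    exact this
  -- The code is built for typical source blocks only, with error at most ε/2; the atypical blocks
  -- are counted as errors and contribute at most another ε/2.
  let Q' : (Fin n → Source X₁ X₂ X₃ V₁ V₂) → ℝ := fun s => Q n s * ind (s ∈ typicalSet q δ n)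
  have hQ'0 : ∀ s, 0 ≤ Q' s := fun s => mul_nonneg ((hQ n).1 s) (ind_nonneg _)
  have hQ'1 : ∑ s, Q' s ≤ 1 := by
    rw [← (hQ n).2]
    exact Finset.sum_le_sum fun s _ => mul_le_of_le_one_right ((hQ n).1 s) (ind_le_one _)
  have hQ't : ∀ s, Q' s ≠ 0 → s ∈ typicalSet q δ n := fun s hs => by
    by_contra h
    exact hs (by simp only [Q', ind_false h, mul_zero])
  have c1 : ∀ b d, 0 ≤ channel₁ p b d := fun b d => condLaw_nonneg hp.1.1 _ _ b d
  have c2 : ∀ b d, 0 ≤ channel₂ p b d := fun b d => condLaw_nonneg hp.1.1 _ _ b d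
  obtain ⟨e₁, e₂, d, hd⟩ := exists_code (F₁ := F₁) (M₁ := M₁) (F₂ := F₂) (M₂ := M₂)
    (S := Fin n → Source X₁ X₂ X₃ V₁ V₂) (U := Fin n → U₁) (V := Fin n → U₂)
    (fun s t => ((s t).1, (s t).2.2.2.1)) (fun s t => ((s t).2.1, (s t).2.2.2.1))
    (fun s t => ((s t).2.2.1, (s t).2.2.2.1, (s t).2.2.2.2)) hQ'0 hQ'1
    (W₁ := blockProd (channel₁ p)) (blockProd_nonneg c1) (sum_blockProd (sum_condLaw p _ _))
    (W₂ := fun u a => blockProd (channel₂ p) fun t => (u t, a t))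
    (fun u a => blockProd_nonneg c2 _) (fun u a => sum_blockProd (sum_condLaw p _ _) _)
    (list₁ p γ) (list p γ) (fun s => {x | (fun t => (s t, x.1 t, x.2 t)) ∈ typicalSet p ε n})
    (card_list₁_le hp hγ) (card_list_le hp hγ) (fun a u => card_list_section_le hp hγ a u)
    (Real.exp_pos (-(n * (h₁ - γ)))).le (Real.exp_pos (-(n * (h₂ - γ)))).le
    (fun s hs => (hn₁ n hnn₁ s (hQ't s hs)).1) (fun s hs => (hn₁ n hnn₁ s (hQ't s hs)).2.1)
    (fun s hs => (hn₁ n hnn₁ s (hQ't s hs)).2.2) (η := ε / 2) (by positivity) (by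
      have g1 := hcov h₁
      have g2 := hcov h₂
      rw [le_div_iff₀ (by positivity)] at hγ₅
      simp only [← hk₁, ← hk₂, ← hk, ← hN]
      change 16 * (((F₁ : ℝ) - 1) * _) + _ + 2 * (16 * (((F₂ : ℝ) - 1) * _) + _) + _ ≤ _
      linarith)
  refine ⟨⟨M₁, M₂, fun x v => e₁ fun t => (x t, v t), fun x v => e₂ fun t => (x t, v t),
    fun x v v' => d fun t => (x t, v t, v' t)⟩, ?_, ?_, ?_⟩
  · exact logb_floor_exp_add_one_le hR₁0 hn0 hnε' hε
  · exact logb_floor_exp_add_one_le hR₂0 hn0 hnε' hε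
  · rw [prob_eq_sum_ind]
    have hT := (hn₂ n hnn₂.le).le
    rw [prob_eq_sum_ind] at hT
    have hQs := (hQ n).2
    have hle : ∑ s, Q n s * (1 - ind (s ∈ typicalSet q δ n)) ≤ ε / 2 := by
      simp only [mul_sub, mul_one, Finset.sum_sub_distrib, hQs]
      linarith
    refine le_trans (Finset.sum_le_sum fun s _ => ?_)
      ((Finset.sum_add_distrib (s := Finset.univ)).trans_le (add_le_add hd hle) |>.trans
        (by linarith))
    by_cases hs : s ∈ typicalSet q δ n
    · simp only [Q', ind_true hs, mul_one, sub_self, mul_zero, add_zero]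
      exact le_rfl
    · simp only [Q', ind_false hs, mul_zero, zero_mul, zero_add, sub_zero]
      exact mul_le_mul_of_nonneg_left (ind_le_one _) ((hQ n).1 s)

end Achievability

end CoopBT

theorem mainTheorem9
    {X₁ X₂ X₃ V₁ V₂ U₁ U₂ : Type*}
    [Fintype X₁] [Fintype X₂] [Fintype X₃] [Fintype V₁] [Fintype V₂] [Fintype U₁] [Fintype U₂]
    (q : CoopBT.Source X₁ X₂ X₃ V₁ V₂ → ℝ)
    (hq : q ∈ stdSimplex ℝ (CoopBT.Source X₁ X₂ X₃ V₁ V₂))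
    (Q : (n : ℕ) → (Fin n → CoopBT.Source X₁ X₂ X₃ V₁ V₂) → ℝ)
    (hQ : ∀ n, Q n ∈ stdSimplex ℝ (Fin n → CoopBT.Source X₁ X₂ X₃ V₁ V₂))
    (hQq : CoopBT.AsymptoticallyTypical q Q) :
    (∀ p ∈ CoopBT.admissible (U₁ := U₁) (U₂ := U₂) q,
      CoopBT.rateRegion p ⊆ CoopBT.achievableRates Q p) ∧
    closure (⋃ p ∈ CoopBT.admissible (U₁ := U₁) (U₂ := U₂) q, CoopBT.rateRegion p) ⊆
      closure (⋃ p ∈ CoopBT.admissible (U₁ := U₁) (U₂ := U₂) q,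
        CoopBT.achievableRates Q p) := by
  have h : ∀ p ∈ CoopBT.admissible (U₁ := U₁) (U₂ := U₂) q,
      CoopBT.rateRegion p ⊆ CoopBT.achievableRates Q p :=
    fun p hp => CoopBT.rateRegion_subset_achievableRates hq hQ hQq hp
  exact ⟨h, closure_mono (Set.iUnion₂_mono h)⟩
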